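/- Throughout, digraphs have no loops or multiple arcs, and $\mathbb{Z}_m^\ast=\mathbb{Z}_m\setminus\{0\}$. For $S\subseteq\mathbb{Z}_m^\ast$, let $\vec{C}(m;S)$ be the directed circulant with vertex set $\mathbb{Z}_m$ and arc set $\{(i,i+d): i\in\mathbb{Z}_m,\ d\in S\}$. Let $K_n^\ast$ be the complete symmetric digraph on $n$ vertices (all arcs $(u,v)$ with $u\neq v$). A decomposition of a digraph is a collection of subdigraphs whose arc sets partition its arc set; it is resolvable if it can be partitioned into resolution classes, i.e. subcollections whose vertex sets partition the vertex set of the digraph. $\vec{C}_m$ denotes the directed cycle of length $m$. Let $m\ge 7$ be an odd integer with $3\nmid m$ and $m\ne 11$. Let $k=\frac{m-1}{2}$, and define $d, s_1', s_2', t_2', t_1$ by the following table. \[ \begin{array}{c|cccc} & k\equiv 0\ (\mathrm{mod}\ 4) & k\equiv 1\ (\mathrm{mod}\ 4) & k\equiv 2\ (\mathrm{mod}\ 4) & k\equiv 3\ (\mathrm{mod}\ 4)\\ \hline d & (7k+8)/4 & (5k+7)/4 & (3k+6)/4 & (k+5)/4\\ s_1' & k/4 & (3k+1)/4 & (5k+2)/4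 & (7k+3)/4\\ s_2' & (3k+4)/4 & (k+3)/4 & (7k+6)/4 & (5k+5)/4\\ t_2' & (k-2)/2 & (3k-1)/2 & (k-2)/2 & (3k-1)/2\\ t_1 & (3k+2)/2 & (k+1)/2 & (3k+2)/2 & (k+1)/2 \end{array} \] In addition, let $t_1'=s_2=k$, $s_1=2k-1$ and $t_2=t_2'$. Then $\gcd(d,m)=1$, and hence for each $i=1,2$ there exists a unique $r_i\in\mathbb{Z}_m$ such that $s_i'+r_i d=t_i'$ in $\mathbb{Z}_m$. Furthermore, let $a_i=(t_i,s_i)$ and $d_i^Y=s_i-t_i$ in $\mathbb{Z}_m$, for $i=1,2$. Assume that there exists a set $S\subseteq\mathbb{Z}_m^\ast$ such that: ($Y_1$) $k+1\notin S$; ($Y_2$) $d_1^Y, d_2^Y\in S$; ($Y_3$) $\vec{C}(m;\mathbb{Z}_m^\ast\setminus(S\cup\{k+1\}))$ admits a decomposition into directed $m$-cycles; and ($Y_4$) the digraph obtained from $\vec{C}(m;S)$ by deleting the arcs $a_1$ and $a_2$ admits a decomposition into directed $m$-cycles and two vertex-disjoint directed paths: an $(s_1,t_1)$-path of length $r_1$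 and an $(s_2,t_2)$-path of length $r_2$ (where $r_i$ is represented in $\{0,1,\ldots,m-1\}$). Then $K_{2m}^\ast$ admits a resolvable decomposition into directed $m$-cycles. -/

import Mathlib

namespace Digraph

/-- A subdigraph of a digraph `D`: a set of vertices together with a set of arcs of `D` whose
two ends lie in that set. -/
@[ext]
structure Subdigraph {V : Type*} (D : Digraph V) where
  /-- The vertex set of the subdigraph. -/
  verts : Set V
  /-- `Adj u v` says that `(u, v)` is an arc of the subdigraph. -/
  Adj : V → V → Prop
  adj_sub : ∀ u v, Adj u v → D.Adj u v
  tail_mem : ∀ u v, Adj u v → u ∈ verts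
  head_mem : ∀ u v, Adj u v → v ∈ verts

/-- The complete symmetric digraph with vertex set `V`: all arcs `(u, v)` with `u ≠ v`. -/
def completeSymmetric (V : Type*) : Digraph V where
  Adj u v := u ≠ v

/-- The directed circulant of order `m` with connection set `S`: its vertex set is `ZMod m` and
its arcs are the pairs `(i, i + d)` with `d ∈ S`. -/
def directedCirculant (m : ℕ) (S : Set (ZMod m)) : Digraph (ZMod m) where
  Adj u v := ∃ d ∈ S, v = u + d

/-- The digraph obtained from `D` by deleting all arcs in the set `A`. -/
def deleteArcs {V : Type*} (D : Digraph V) (A : Set (V × V)) : Digraph V where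
  Adj u v := D.Adj u v ∧ (u, v) ∉ A

/-- The subdigraph `H` is a directed cycle of length `m`: its vertices are `m` distinct vertices
`c 0, …, c (m - 1)` and its arcs are exactly the pairs `(c i, c (i + 1))`, where `i` is
taken modulo `m`. -/
def Subdigraph.IsDirectedCycle {V : Type*} {D : Digraph V} (H : D.Subdigraph) (m : ℕ) : Prop :=
  2 ≤ m ∧ ∃ c : ZMod m → V, Function.Injective c ∧ H.verts = Set.range c ∧
    ∀ u v, H.Adj u v ↔ ∃ i : ZMod m, u = c i ∧ v = c (i + 1)

/-- The subdigraph `H` is a directed `(s, t)`-path of length `r`: its vertices are `r + 1` distinct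
vertices `p 0 = s, …, p r = t` and its arcs are exactly the pairs `(p i, p (i + 1))`
with `i < r`. -/
def Subdigraph.IsDirectedPath {V : Type*} {D : Digraph V} (H : D.Subdigraph) (s t : V) (r : ℕ) :
    Prop :=
  ∃ p : Fin (r + 1) → V, Function.Injective p ∧ p 0 = s ∧ p (Fin.last r) = t ∧
    H.verts = Set.range p ∧
    ∀ u v, H.Adj u v ↔ ∃ i : Fin r, u = p i.castSucc ∧ v = p i.succ

/-- The arc sets of the members of the collection `𝒟` of subdigraphs partition the arc set
of `D`. -/
def IsDecomposition {V : Type*} (D : Digraph V) (𝒟 : Set D.Subdigraph) : Prop :=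
  (∀ H ∈ 𝒟, ∃ u v, H.Adj u v) ∧ ∀ u v, D.Adj u v → ∃! H, H ∈ 𝒟 ∧ H.Adj u v

/-- A decomposition of `D` into directed cycles of length `m`. -/
def IsDirectedCycleDecomposition {V : Type*} (D : Digraph V) (m : ℕ) (𝒟 : Set D.Subdigraph) :
    Prop :=
  D.IsDecomposition 𝒟 ∧ ∀ H ∈ 𝒟, H.IsDirectedCycle m

/-- The vertex sets of the members of `R` partition the vertex set of `D`. -/
def IsResolutionClass {V : Type*} (D : Digraph V) (R : Set D.Subdigraph) : Prop :=
  (∀ H ∈ R, H.verts.Nonempty) ∧ ∀ v : V, ∃! H, H ∈ R ∧ v ∈ H.verts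

/-- The collection `𝒟` can be partitioned into resolution classes. -/
def IsResolvable {V : Type*} (D : Digraph V) (𝒟 : Set D.Subdigraph) : Prop :=
  ∃ P : Set (Set D.Subdigraph),
    (∀ R ∈ P, R.Nonempty ∧ R ⊆ 𝒟 ∧ D.IsResolutionClass R) ∧
    ∀ H ∈ 𝒟, ∃! R, R ∈ P ∧ H ∈ R

/-- `D` admits a decomposition into directed cycles of length `m`. -/
def AdmitsDirectedCycleDecomposition {V : Type*} (D : Digraph V) (m : ℕ) : Prop :=
  ∃ 𝒟 : Set D.Subdigraph, D.IsDirectedCycleDecomposition m 𝒟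

/-- `D` admits a resolvable decomposition into directed cycles of length `m`. -/
def AdmitsResolvableDirectedCycleDecomposition {V : Type*} (D : Digraph V) (m : ℕ) : Prop :=
  ∃ 𝒟 : Set D.Subdigraph, D.IsDirectedCycleDecomposition m 𝒟 ∧ D.IsResolvable 𝒟

/-- `D` admits a decomposition into directed cycles of length `m` and two vertex-disjoint directed
paths: for `i = 0, 1`, an `(s i, t i)`-path of length `r i`. -/
def AdmitsDirectedCyclesTwoPathsDecomposition {V : Type*} (D : Digraph V) (m : ℕ)
    (s t : Fin 2 → V) (r : Fin 2 → ℕ) : Prop :=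
  ∃ (𝒟 : Set D.Subdigraph) (Q : Fin 2 → D.Subdigraph),
    D.IsDecomposition 𝒟 ∧
    (∀ i, Q i ∈ 𝒟 ∧ (Q i).IsDirectedPath (s i) (t i) (r i)) ∧
    Disjoint (Q 0).verts (Q 1).verts ∧
    ∀ H ∈ 𝒟, (∀ i, H ≠ Q i) → H.IsDirectedCycle m

end Digraph

namespace CirculantParam

/-! The parameters of the construction, as functions of `k = (m - 1) / 2`. All the divisions below
are exact, and so are the subtractions for `k ≥ 2`. The index `i = 1, 2` of the parameters is
written `0, 1 : Fin 2`. -/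

/-- The parameter `d`. -/
def d (k : ℕ) : ℕ :=
  if k % 4 = 0 then (7 * k + 8) / 4
  else if k % 4 = 1 then (5 * k + 7) / 4
  else if k % 4 = 2 then (3 * k + 6) / 4
  else (k + 5) / 4

/-- The parameters `s₁'` and `s₂'`. -/
def s' (k : ℕ) : Fin 2 → ℕ :=
  if k % 4 = 0 then ![k / 4, (3 * k + 4) / 4]
  else if k % 4 = 1 then ![(3 * k + 1) / 4, (k + 3) / 4]
  else if k % 4 = 2 then ![(5 * k + 2) / 4, (7 * k + 6) / 4]
  else ![(7 * k + 3) / 4, (5 * k + 5) / 4]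

/-- The parameters `t₁' = k` and `t₂'`. -/
def t' (k : ℕ) : Fin 2 → ℕ :=
  ![k, if k % 2 = 0 then (k - 2) / 2 else (3 * k - 1) / 2]

/-- The parameters `s₁ = 2k - 1` and `s₂ = k`. -/
def s (k : ℕ) : Fin 2 → ℕ := ![2 * k - 1, k]

/-- The parameters `t₁` and `t₂ = t₂'`. -/
def t (k : ℕ) : Fin 2 → ℕ :=
  ![if k % 2 = 0 then (3 * k + 2) / 2 else (k + 1) / 2, t' k 1]

end CirculantParam

/-!
The vertices of the complete symmetric digraph are two copies `x_i`, `y_i` of `ZMod m`, and an arc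
is described by its type (`xx`, `xy`, `yx`, `yy`) and its difference. Write `m = 2 * k + 1`. A
resolution class is a pair of disjoint directed `m`-cycles, which gives out-degree `1` to each
vertex; all out-degrees being `2 * m - 1`, any `2 * m - 1` such pairs which cover all arcs form a
resolvable decomposition (`Digraph.admitsResolvable_of_covering`). There are three kinds of
classes.

* The `m` translates of one *starter* (`Starter.exists_starter`), a pair of cycles composed of
  zigzags which contains one arc for each difference of type `xy` except `k + 3`, for each
  difference of type `yx` except `-1`, for the difference `1` of type `xx` and for the difference
  `k + 1` of type `yy`. These classes use up all arcs with such a type and difference.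

* Two special classes. In `ZMod m` the parameters are fractions with small denominators which do
  not depend on the residue of `k` modulo `4`, for example `d = 9 / 8`, `r₁ = -1 / 3`,
  `r₂ = -5 / 3`. So the two given paths together visit `m` vertices `y_i`, that is all of them.
  Closing each of them by a path with all differences equal to `q = 2 * d` of type `xx`, whose
  length is that of the other path, gives the first special class (`exists_path_pair`). It uses
  two arcs of type `xy` with difference `k + 3`, two arcs of type `yx` with difference `-1`, and
  all but two of the arcs of type `xx` with difference `q`. All arcs of type `xy` with difference
  `k + 3` and of type `yx` with difference `-1` form one cycle of length `2 * m`, since their sum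
  `k + 2 = 3 / 2` is a unit. When the four used arcs are replaced by the two omitted arcs with
  difference `q` and the two deleted arcs `a₁`, `a₂`, this cycle falls apart into two cycles of
  length `m`, the second special class (`exists_redirected_pair`).

* `m - 3` classes consisting of one of the given `m`-cycles on the `y_i` and a Hamiltonian cycle
  on the `x_i`. The latter come from a decomposition of the circulant with all differences except
  `0`, `1` and `q` (`hamiltonCovered_compl`).

For this decomposition the differences `-1` and `-q` are units and yield a cycle each (unless
`q = -1`, when neither is left). The others come in pairs `±a`, and these are grouped into sets
`{±a, ±(a + 1)}`, up to the units `±2` and `±k` where the number is odd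
(`hamiltonCovered_consecutive`). If both `a` and `a + 1` are units there is nothing to do.
Otherwise consider the undirected edges in the directions `a` and `a + 1` as a grid on a torus,
whose rows are the cosets of `a` and whose columns are the cosets of `a + 1`. Exchanging the
horizontal and the vertical edges of some squares without common edges keeps both graphs
2-regular; the squares are chosen such that both graphs become connected, hence Hamiltonian cycles
(`hamiltonCovered_of_switchGraph`). Their orientations in both directions are the four cycles.
-/

/-! ### Resolvable decompositions from pairs of directed cycles -/

/-- Simultaneous shift by one on two disjoint copies of `ZMod m`. -/
def doubleShift (m : ℕ) : Equiv.Perm (ZMod m ⊕ ZMod m) :=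
  Equiv.sumCongr (Equiv.addRight 1) (Equiv.addRight 1)

/-- A bijection `c` from two disjoint copies of `ZMod m` onto `V` encodes two disjoint directed
`m`-cycles which together span `V`; this is the out-neighbour of `u` in their union. -/
def pairNext {m : ℕ} {V : Type*} (c : ZMod m ⊕ ZMod m ≃ V) (u : V) : V :=
  c (doubleShift m (c.symm u))

theorem pairNext_inl {m : ℕ} {V : Type*} (c : ZMod m ⊕ ZMod m ≃ V) (i : ZMod m) :
    pairNext c (c (Sum.inl i)) = c (Sum.inl (i + 1)) := by
  simp [pairNext, doubleShift]

theorem pairNext_inr {m : ℕ} {V : Type*} (c : ZMod m ⊕ ZMod m ≃ V) (i : ZMod m) :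
    pairNext c (c (Sum.inr i)) = c (Sum.inr (i + 1)) := by
  simp [pairNext, doubleShift]

theorem pairNext_ne {m : ℕ} (hm : 2 ≤ m) {V : Type*} (c : ZMod m ⊕ ZMod m ≃ V) (u : V) :
    pairNext c u ≠ u := by
  have : Fact (1 < m) := ⟨hm⟩
  obtain ⟨w, rfl⟩ := c.surjective u
  rcases w with i | i
  · rw [pairNext_inl]; simp
  · rw [pairNext_inr]; simp

/-- The embedding of `ZMod m` as the summand selected by a Boolean. -/
def copyOf {m : ℕ} (b : Bool) : ZMod m → ZMod m ⊕ ZMod m := if b then Sum.inl else Sum.inr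

theorem copyOf_injective {m : ℕ} (b : Bool) : Function.Injective (copyOf (m := m) b) := by
  cases b
  · exact Sum.inr_injective
  · exact Sum.inl_injective

theorem exists_copyOf {m : ℕ} (w : ZMod m ⊕ ZMod m) : ∃ b i, w = copyOf b i := by
  rcases w with i | i
  · exact ⟨true, i, rfl⟩
  · exact ⟨false, i, rfl⟩

theorem copyOf_bool_eq {m : ℕ} {b b' : Bool} {i i' : ZMod m} (h : copyOf b i = copyOf b' i') :
    b = b' := by
  cases b <;> cases b' <;> simp_all [copyOf]

theorem pairNext_copyOf {m : ℕ} {V : Type*} (c : ZMod m ⊕ ZMod m ≃ V) (b : Bool) (i : ZMod m) :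
    pairNext c (c (copyOf b i)) = c (copyOf b (i + 1)) := by
  cases b
  · exact pairNext_inr c i
  · exact pairNext_inl c i

namespace Digraph

/-- One of the two directed cycles encoded by the bijection `c`, as a subdigraph of the complete
symmetric digraph. -/
def cycleSubdigraph {m : ℕ} (hm : 2 ≤ m) {V : Type*} (c : ZMod m ⊕ ZMod m ≃ V) (b : Bool) :
    (completeSymmetric V).Subdigraph where
  verts := Set.range fun i => c (copyOf b i)
  Adj u v := ∃ i, u = c (copyOf b i) ∧ v = c (copyOf b (i + 1))
  adj_sub := by
    rintro u v ⟨i, rfl, rfl⟩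
    rw [← pairNext_copyOf]
    exact (pairNext_ne hm c _).symm
  tail_mem := by rintro u v ⟨i, rfl, rfl⟩; exact ⟨i, rfl⟩
  head_mem := by rintro u v ⟨i, rfl, rfl⟩; exact ⟨i + 1, rfl⟩

theorem cycleSubdigraph_isDirectedCycle {m : ℕ} (hm : 2 ≤ m) {V : Type*}
    (c : ZMod m ⊕ ZMod m ≃ V) (b : Bool) : (cycleSubdigraph hm c b).IsDirectedCycle m :=
  ⟨hm, fun i => c (copyOf b i), c.injective.comp (copyOf_injective b), rfl, fun _ _ => Iff.rfl⟩

theorem pairNext_of_cycleSubdigraph_adj {m : ℕ} {hm : 2 ≤ m} {V : Type*}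
    {c : ZMod m ⊕ ZMod m ≃ V} {b : Bool} {u v : V} (h : (cycleSubdigraph hm c b).Adj u v) :
    pairNext c u = v := by
  obtain ⟨i, rfl, rfl⟩ := h
  exact pairNext_copyOf c b i

/-- A family of spanning pairs of disjoint directed `m`-cycles which uses every arc of the complete
symmetric digraph exactly once is a resolvable decomposition. -/
theorem admitsResolvable_of_pairs {m : ℕ} (hm : 2 ≤ m) {V I : Type*}
    (c : I → (ZMod m ⊕ ZMod m ≃ V)) (hc : ∀ u v, u ≠ v → ∃! t, pairNext (c t) u = v) :
    (completeSymmetric V).AdmitsResolvableDirectedCycleDecomposition m := by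
  have : NeZero m := ⟨by omega⟩
  -- an arc determines the index of the pair and the cycle of that pair which contain it
  have key : ∀ t b t' b' u v, (cycleSubdigraph hm (c t) b).Adj u v →
      (cycleSubdigraph hm (c t') b').Adj u v → t = t' ∧ b = b' := by
    intro t b t' b' u v h h'
    have ht : t = t' := (hc u v ((cycleSubdigraph hm (c t) b).adj_sub u v h)).unique
      (pairNext_of_cycleSubdigraph_adj h) (pairNext_of_cycleSubdigraph_adj h')
    subst ht
    refine ⟨rfl, ?_⟩
    obtain ⟨i, hi, -⟩ := h
    obtain ⟨i', hi', -⟩ := h'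
    exact copyOf_bool_eq ((c t).injective (hi.symm.trans hi'))
  have hadj : ∀ t b, (cycleSubdigraph hm (c t) b).Adj (c t (copyOf b 0)) (c t (copyOf b (0 + 1))) :=
    fun t b => ⟨0, rfl, rfl⟩
  refine ⟨Set.range fun x : I × Bool => cycleSubdigraph hm (c x.1) x.2, ⟨⟨?_, ?_⟩, ?_⟩,
    Set.range fun t => Set.range fun b => cycleSubdigraph hm (c t) b, ?_, ?_⟩
  · rintro _ ⟨⟨t, b⟩, rfl⟩
    exact ⟨_, _, hadj t b⟩
  · intro u v huv
    obtain ⟨t, ht, -⟩ := hc u v huv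
    obtain ⟨w, rfl⟩ := (c t).surjective u
    obtain ⟨b, i, rfl⟩ := exists_copyOf w
    rw [pairNext_copyOf] at ht
    have h1 : (cycleSubdigraph hm (c t) b).Adj (c t (copyOf b i)) v := ⟨i, rfl, ht.symm⟩
    refine ⟨_, ⟨⟨(t, b), rfl⟩, h1⟩, ?_⟩
    rintro _ ⟨⟨⟨t', b'⟩, rfl⟩, h'⟩
    obtain ⟨rfl, rfl⟩ := key _ _ _ _ _ _ h1 h'
    rfl
  · rintro _ ⟨⟨t, b⟩, rfl⟩
    exact cycleSubdigraph_isDirectedCycle hm (c t) b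
  · rintro _ ⟨t, rfl⟩
    refine ⟨⟨_, true, rfl⟩, ?_, ?_, ?_⟩
    · rintro _ ⟨b, rfl⟩
      exact ⟨(t, b), rfl⟩
    · rintro _ ⟨b, rfl⟩
      exact ⟨_, 0, rfl⟩
    · intro v
      obtain ⟨w, rfl⟩ := (c t).surjective v
      obtain ⟨b, i, rfl⟩ := exists_copyOf w
      refine ⟨_, ⟨⟨b, rfl⟩, i, rfl⟩, ?_⟩
      rintro _ ⟨⟨b', rfl⟩, i', hi'⟩
      rw [copyOf_bool_eq ((c t).injective hi')]
  · rintro _ ⟨⟨t, b⟩, rfl⟩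
    refine ⟨_, ⟨⟨t, rfl⟩, b, rfl⟩, ?_⟩
    rintro _ ⟨⟨t', rfl⟩, b', hb'⟩
    have h := hadj t b
    have h' := h
    dsimp only at hb'
    rw [← hb'] at h'
    rw [(key _ _ _ _ _ _ h h').1]

/-- For a family of `2 * m - 1` pairs of cycles it is enough that every arc is used: the out-degree
of each vertex is `2 * m - 1`, so no arc is used twice. -/
theorem admitsResolvable_of_covering {m : ℕ} (hm : 2 ≤ m) {I : Type*} [Fintype I]
    (hI : Fintype.card I = 2 * m - 1)
    (c : I → Equiv.Perm (ZMod m ⊕ ZMod m)) (hc : ∀ u v, u ≠ v → ∃ t, pairNext (c t) u = v) :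
    (completeSymmetric (Fin (2 * m))).AdmitsResolvableDirectedCycleDecomposition m := by
  have : NeZero m := ⟨by omega⟩
  have e : ZMod m ⊕ ZMod m ≃ Fin (2 * m) :=
    Fintype.equivOfCardEq (by simp [ZMod.card, two_mul])
  refine admitsResolvable_of_pairs hm (fun t => (c t).trans e) fun u v huv => ?_
  have hbij : ∀ w, Function.Bijective fun t =>
      (⟨pairNext (c t) w, pairNext_ne hm _ _⟩ : {v // v ≠ w}) := by
    intro w
    rw [Fintype.bijective_iff_surjective_and_card]
    refine ⟨?_, ?_⟩
    · rintro ⟨v, hv⟩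
      obtain ⟨t, ht⟩ := hc w v hv.symm
      exact ⟨t, Subtype.ext ht⟩
    · have h2 : Fintype.card {v // v ≠ w} = Fintype.card (ZMod m ⊕ ZMod m) - 1 :=
        Set.card_ne_eq w
      rw [hI, h2]
      simp [ZMod.card, two_mul]
  have hn : ∀ t, pairNext ((c t).trans e) u = e (pairNext (c t) (e.symm u)) := fun t => rfl
  obtain ⟨t, ht, hu⟩ := (hbij (e.symm u)).existsUnique
    ⟨e.symm v, fun h => huv (e.symm.injective h).symm⟩
  refine ⟨t, ?_, fun t' ht' => hu t' ?_⟩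
  · dsimp only
    rw [hn, show pairNext (c t) (e.symm u) = e.symm v from congrArg Subtype.val ht]
    simp
  · dsimp only at ht'
    rw [hn] at ht'
    apply Subtype.ext
    simp [← ht']

end Digraph

/-! ### Hamiltonian cycles in circulants -/

/-- The out-neighbour of `u` in the directed Hamiltonian cycle `c 0, c 1, …` on `ZMod m`. -/
def cycleNext {m : ℕ} (c : Equiv.Perm (ZMod m)) (u : ZMod m) : ZMod m := c (c.symm u + 1)

theorem cycleNext_apply {m : ℕ} (c : Equiv.Perm (ZMod m)) (i : ZMod m) :
    cycleNext c (c i) = c (i + 1) := by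
  simp [cycleNext]

/-- The directed circulant with connection set `D` is covered by `|D|` directed Hamiltonian cycles
(hence decomposed into them, as its out-degrees are `|D|`). The cycles are indexed by the elements
of `D`. -/
def HamiltonCovered {m : ℕ} (D : Set (ZMod m)) : Prop :=
  ∃ c : ZMod m → Equiv.Perm (ZMod m), ∀ δ ∈ D, ∀ u, ∃ t ∈ D, cycleNext (c t) u = u + δ

theorem HamiltonCovered.union {m : ℕ} {D E : Set (ZMod m)} (hD : HamiltonCovered D)
    (hE : HamiltonCovered E) (h : Disjoint D E) : HamiltonCovered (D ∪ E) := by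
  classical
  obtain ⟨c, hc⟩ := hD
  obtain ⟨c', hc'⟩ := hE
  refine ⟨fun t => if t ∈ D then c t else c' t, ?_⟩
  rintro δ (hδ | hδ) u
  · obtain ⟨t, ht, h1⟩ := hc δ hδ u
    exact ⟨t, Or.inl ht, by simp only [if_pos ht, h1]⟩
  · obtain ⟨t, ht, h1⟩ := hc' δ hδ u
    exact ⟨t, Or.inr ht, by simp only [if_neg (h.notMem_of_mem_right ht), h1]⟩

theorem hamiltonCovered_empty {m : ℕ} : HamiltonCovered (∅ : Set (ZMod m)) :=
  ⟨fun _ => 1, fun _ h => h.elim⟩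

/-- Multiplication by a unit permutes the circulants. -/
theorem HamiltonCovered.smul {m : ℕ} {D : Set (ZMod m)} (hD : HamiltonCovered D)
    (r : (ZMod m)ˣ) : HamiltonCovered ((fun x => (r : ZMod m) * x) '' D) := by
  obtain ⟨c, hc⟩ := hD
  refine ⟨fun t => (c ((r⁻¹ : (ZMod m)ˣ) * t)).trans r.mulLeft, ?_⟩
  rintro _ ⟨δ, hδ, rfl⟩ u
  obtain ⟨t, ht, h1⟩ := hc δ hδ ((r⁻¹ : (ZMod m)ˣ) * u)
  refine ⟨_, ⟨t, ht, rfl⟩, ?_⟩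
  have h2 : ∀ (p : Equiv.Perm (ZMod m)), cycleNext (p.trans r.mulLeft) u
      = r * cycleNext p ((r⁻¹ : (ZMod m)ˣ) * u) := fun p => rfl
  simp only [h2, Units.inv_mul_cancel_left, h1, mul_add, Units.mul_inv_cancel_left]

theorem hamiltonCovered_singleton {m : ℕ} {r : ZMod m} (hr : IsUnit r) :
    HamiltonCovered ({r} : Set (ZMod m)) := by
  obtain ⟨r, rfl⟩ := hr
  refine ⟨fun _ => r.mulLeft, ?_⟩
  rintro _ rfl u
  refine ⟨_, rfl, ?_⟩
  simp [cycleNext, mul_add]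

/-- A connected graph on `m ≥ 3` vertices in which every vertex has two neighbours is a Hamiltonian
cycle. -/
theorem exists_cycle_of_connected {m : ℕ} [NeZero m] (hm : 3 ≤ m) (G : SimpleGraph (ZMod m))
    (hG : G.Connected) (h2 : ∀ v, (G.neighborSet v).ncard = 2) :
    ∃ c : Equiv.Perm (ZMod m), ∀ u v, G.Adj u v → cycleNext c u = v ∨ cycleNext c v = u := by
  have hcyc : G.IsCycles := fun v _ => h2 v
  have hne : (G.neighborSet 0).Nonempty := by
    rw [← Set.ncard_pos, h2]; norm_num
  obtain ⟨p, hp, hv⟩ := hcyc.exists_cycle_toSubgraph_verts_eq_connectedComponentSupp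
    (c := G.connectedComponentMk 0) (v := 0) rfl hne
  have hall : ∀ v, v ∈ p.support := by
    intro v
    rw [← SimpleGraph.Walk.mem_verts_toSubgraph, hv]
    exact SimpleGraph.ConnectedComponent.sound (hG.preconnected v 0)
  have h3 := hp.three_le_length
  have hget : ∀ v, ∃ i < p.length, p.getVert i = v := by
    intro v
    obtain ⟨i, hi, hle⟩ := SimpleGraph.Walk.mem_support_iff_exists_getVert.1 (hall v)
    rcases hle.lt_or_eq with hlt | rfl
    · exact ⟨i, hlt, hi⟩
    · refine ⟨0, by omega, ?_⟩
      rw [← hi, SimpleGraph.Walk.getVert_zero, SimpleGraph.Walk.getVert_length]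
  have hinj := hp.getVert_injOn'
  have hlen : p.length = m := by
    have hb : Function.Bijective fun i : Fin p.length => p.getVert i := by
      refine ⟨fun i j hij => Fin.ext (hinj ?_ ?_ hij), fun v => ?_⟩
      · have := i.2
        simp only [Set.mem_ofPred_eq]
        omega
      · have := j.2
        simp only [Set.mem_ofPred_eq]
        omega
      · obtain ⟨i, hi, h⟩ := hget v
        exact ⟨⟨i, hi⟩, h⟩
    simpa [ZMod.card] using Fintype.card_of_bijective hb
  have hf : Function.Surjective fun i : ZMod m => p.getVert i.val := by
    intro v
    obtain ⟨i, hi, h⟩ := hget v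
    exact ⟨i, by simp only [ZMod.val_cast_of_lt (hlen ▸ hi), h]⟩
  have hadj : ∀ i : ZMod m, G.Adj (p.getVert i.val) (p.getVert (i + 1).val) := by
    intro i
    have hi := ZMod.val_lt i
    have h1 := p.adj_getVert_succ (i := i.val) (by omega)
    by_cases h : i.val + 1 < m
    · have : (i + 1).val = i.val + 1 := by
        conv_lhs => rw [← ZMod.natCast_zmod_val i]
        rw [← Nat.cast_add_one, ZMod.val_cast_of_lt h]
      rwa [this]
    · have h0 : i + 1 = 0 := by
        rw [← ZMod.natCast_zmod_val i, ← Nat.cast_add_one, show i.val + 1 = m by omega,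
          ZMod.natCast_self]
      rw [show i.val + 1 = p.length by omega, SimpleGraph.Walk.getVert_length] at h1
      rwa [h0, ZMod.val_zero, SimpleGraph.Walk.getVert_zero]
  let c : Equiv.Perm (ZMod m) :=
    Equiv.ofBijective _ (Finite.surjective_iff_bijective.1 hf)
  refine ⟨c, fun u v huv => ?_⟩
  obtain ⟨i, rfl⟩ := c.surjective u
  have hne2 : c (i + 1) ≠ c (i - 1) := by
    intro h
    have h' : (2 : ZMod m) = 0 := by linear_combination c.injective h
    have : ((2 : ℕ) : ZMod m) = 0 := by exact_mod_cast h'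
    rw [ZMod.natCast_eq_zero_iff] at this
    exact absurd (Nat.le_of_dvd (by norm_num) this) (by omega)
  have hsub : {c (i + 1), c (i - 1)} ⊆ G.neighborSet (c i) := by
    rintro w (rfl | rfl)
    · exact hadj i
    · have := hadj (i - 1)
      rw [sub_add_cancel] at this
      exact this.symm
  have heq := Set.eq_of_subset_of_ncard_le hsub (by rw [h2, Set.ncard_pair hne2])
  have hmem : v ∈ ({c (i + 1), c (i - 1)} : Set (ZMod m)) := by rw [heq]; exact huv
  rcases hmem with rfl | rfl
  · left; rw [cycleNext_apply]
  · right; rw [cycleNext_apply, sub_add_cancel]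

/-- The reversal of a directed cycle. -/
theorem cycleNext_neg {m : ℕ} (c : Equiv.Perm (ZMod m)) {u v : ZMod m} (h : cycleNext c v = u) :
    cycleNext ((Equiv.neg (ZMod m)).trans c) u = v := by
  subst h
  obtain ⟨i, rfl⟩ := c.surjective v
  have h1 : ∀ w, cycleNext ((Equiv.neg (ZMod m)).trans c) w = c (-(-(c.symm w) + 1)) :=
    fun w => rfl
  rw [h1, cycleNext_apply, Equiv.symm_apply_apply]
  congr 1
  ring

/-- If the arcs with differences `±a`, `±b` are the arcs of the symmetric orientations of two
Hamiltonian cycles, then they are covered by four directed Hamiltonian cycles. -/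
theorem hamiltonCovered_of_two_cycles {m : ℕ} {a b : ZMod m} (haa : a ≠ -a) (hbb : b ≠ -b)
    (hab : a ≠ b) (hab' : a ≠ -b) (c c' : Equiv.Perm (ZMod m))
    (ha : ∀ u, (cycleNext c u = u + a ∨ cycleNext c (u + a) = u) ∨
      (cycleNext c' u = u + a ∨ cycleNext c' (u + a) = u))
    (hb : ∀ u, (cycleNext c u = u + b ∨ cycleNext c (u + b) = u) ∨
      (cycleNext c' u = u + b ∨ cycleNext c' (u + b) = u)) :
    HamiltonCovered ({a, -a, b, -b} : Set (ZMod m)) := by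
  classical
  have hba : -a ≠ b := fun h => hab' (by rw [← h, neg_neg])
  have hba' : -a ≠ -b := fun h => hab (neg_injective h)
  set n := Equiv.neg (ZMod m)
  let f : ZMod m → Equiv.Perm (ZMod m) := fun t =>
    if t = a then c else if t = -a then n.trans c else if t = b then c' else n.trans c'
  have f1 : f a = c := by simp [f]
  have f2 : f (-a) = n.trans c := by simp [f, haa.symm]
  have f3 : f b = c' := by simp [f, hab.symm, hba.symm]
  have f4 : f (-b) = n.trans c' := by simp [f, hab'.symm, hba'.symm, hbb.symm]
  have key : ∀ u v, ((cycleNext c u = v ∨ cycleNext c v = u) ∨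
      (cycleNext c' u = v ∨ cycleNext c' v = u)) →
      ∃ t ∈ ({a, -a, b, -b} : Set (ZMod m)), cycleNext (f t) u = v := by
    rintro u v ((h | h) | (h | h))
    · exact ⟨a, by simp, by rw [f1, h]⟩
    · exact ⟨-a, by simp, by rw [f2, cycleNext_neg c h]⟩
    · exact ⟨b, by simp, by rw [f3, h]⟩
    · exact ⟨-b, by simp, by rw [f4, cycleNext_neg c' h]⟩
  refine ⟨f, ?_⟩
  rintro δ (rfl | rfl | rfl | rfl) u
  · exact key _ _ (ha u)
  · have := ha (u + -a)
    rw [neg_add_cancel_right] at this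
    exact key _ _ (this.imp Or.symm Or.symm)
  · exact key _ _ (hb u)
  · have := hb (u + -b)
    rw [neg_add_cancel_right] at this
    exact key _ _ (this.imp Or.symm Or.symm)

/-! ### Switching squares of a grid -/

/-- Start from all edges `{v, v + a}`, and for every `t ∈ T` exchange the two edges in direction `a`
of the square `t, t + a, t + a + b, t + b` for its two edges in direction `b`. With `a` and `b`
interchanged this describes the complementary graph among the edges in directions `a` and `b`. -/
def switchGraph {m : ℕ} (a b : ZMod m) (T : Set (ZMod m)) : SimpleGraph (ZMod m) :=
  SimpleGraph.fromRel fun u v =>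
    (v = u + a ∧ u ∉ T ∧ u - b ∉ T) ∨ (v = u + b ∧ (u ∈ T ∨ u - a ∈ T))

theorem switchGraph_adj_fst {m : ℕ} {a b : ZMod m} {T : Set (ZMod m)} (ha : a ≠ 0) {u : ZMod m}
    (h1 : u ∉ T) (h2 : u - b ∉ T) : (switchGraph a b T).Adj u (u + a) := by
  rw [switchGraph, SimpleGraph.fromRel_adj]
  exact ⟨by simpa using ha, Or.inl (Or.inl ⟨rfl, h1, h2⟩)⟩

theorem switchGraph_adj_snd {m : ℕ} {a b : ZMod m} {T : Set (ZMod m)} (hb : b ≠ 0) {u : ZMod m}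
    (h : u ∈ T ∨ u - a ∈ T) : (switchGraph a b T).Adj u (u + b) := by
  rw [switchGraph, SimpleGraph.fromRel_adj]
  exact ⟨by simpa using hb, Or.inl (Or.inr ⟨rfl, h⟩)⟩

/-- If the switched squares have no edges in common, then every vertex has two neighbours. -/
theorem switchGraph_ncard {m : ℕ} {a b : ZMod m} {T : Set (ZMod m)} (haa : a ≠ -a) (hbb : b ≠ -b)
    (hab : a ≠ b) (hab' : a ≠ -b) (hTa : ∀ t ∈ T, t + a ∉ T) (hTb : ∀ t ∈ T, t + b ∉ T)
    (v : ZMod m) : ((switchGraph a b T).neighborSet v).ncard = 2 := by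
  have ha : a ≠ 0 := by rintro rfl; simp at haa
  have hb : b ≠ 0 := by rintro rfl; simp at hbb
  have h13 : ¬ (v ∈ T ∧ v - a ∈ T) := fun h => hTa _ h.2 (by simpa using h.1)
  have h12 : ¬ (v ∈ T ∧ v - b ∈ T) := fun h => hTb _ h.2 (by simpa using h.1)
  have h34 : ¬ (v - a ∈ T ∧ v - a - b ∈ T) := fun h => hTb _ h.2 (by simpa using h.1)
  have h24 : ¬ (v - b ∈ T ∧ v - a - b ∈ T) := fun h =>
    hTa _ h.2 (by rw [show v - a - b + a = v - b by ring]; exact h.1)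
  have hmem : ∀ w, w ∈ (switchGraph a b T).neighborSet v ↔
      (w = v + a ∧ v ∉ T ∧ v - b ∉ T) ∨ (w = v - a ∧ v - a ∉ T ∧ v - a - b ∉ T) ∨
      (w = v + b ∧ (v ∈ T ∨ v - a ∈ T)) ∨ (w = v - b ∧ (v - b ∈ T ∨ v - a - b ∈ T)) := by
    intro w
    rw [SimpleGraph.mem_neighborSet, switchGraph, SimpleGraph.fromRel_adj]
    constructor
    · rintro ⟨-, (⟨rfl, h⟩ | ⟨rfl, h⟩) | (⟨rfl, h⟩ | ⟨rfl, h⟩)⟩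
      · exact Or.inl ⟨rfl, h⟩
      · exact Or.inr (Or.inr (Or.inl ⟨rfl, h⟩))
      · simp only [add_sub_cancel_right]
        exact Or.inr (Or.inl ⟨trivial, h⟩)
      · refine Or.inr (Or.inr (Or.inr ⟨by simp, ?_⟩))
        rw [add_sub_cancel_right, show w + b - a - b = w - a by ring]
        exact h
    · rintro (⟨rfl, h⟩ | ⟨rfl, h⟩ | ⟨rfl, h⟩ | ⟨rfl, h⟩)
      · exact ⟨by simpa using ha, Or.inl (Or.inl ⟨rfl, h⟩)⟩
      · exact ⟨by simpa [sub_eq_add_neg] using ha, Or.inr (Or.inl ⟨by simp, h⟩)⟩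
      · exact ⟨by simpa using hb, Or.inl (Or.inr ⟨rfl, h⟩)⟩
      · refine ⟨by simpa [sub_eq_add_neg] using hb, Or.inr (Or.inr ⟨by simp, ?_⟩)⟩
        rwa [show v - b - a = v - a - b by ring]
  have e1 : v + a ≠ v - a := fun h => haa (by linear_combination h)
  have e2 : v + a ≠ v + b := fun h => hab (by linear_combination h)
  have e3 : v + a ≠ v - b := fun h => hab' (by linear_combination h)
  have e4 : v - a ≠ v + b := fun h => hab' (by linear_combination -h)
  have e5 : v - a ≠ v - b := fun h => hab (by linear_combination -h)
  have e6 : v + b ≠ v - b := fun h => hbb (by linear_combination h)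
  rw [Set.ncard_eq_two]
  by_cases p1 : v ∈ T <;> by_cases p2 : v - b ∈ T <;> by_cases p3 : v - a ∈ T <;>
    by_cases p4 : v - a - b ∈ T <;> simp only [p1, p2, p3, p4, not_true_eq_false, not_false_eq_true,
      and_true, and_false, or_false, false_or, or_true, and_self, or_self] at h13 h12 h34 h24 hmem
  · exact ⟨_, _, e6, Set.ext hmem⟩
  · exact ⟨_, _, e4, Set.ext hmem⟩
  · exact ⟨_, _, e6, Set.ext hmem⟩
  · exact ⟨_, _, e5, Set.ext hmem⟩
  · exact ⟨_, _, e2, Set.ext hmem⟩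
  · exact ⟨_, _, e3, Set.ext hmem⟩
  · exact ⟨_, _, e1, Set.ext hmem⟩

/-- If both the graph obtained by switching and the complementary graph are connected, they are
Hamiltonian cycles. -/
theorem hamiltonCovered_of_switchGraph {m : ℕ} [NeZero m] (hm : 3 ≤ m) {a b : ZMod m}
    {T : Set (ZMod m)} (haa : a ≠ -a) (hbb : b ≠ -b) (hab : a ≠ b) (hab' : a ≠ -b)
    (hTa : ∀ t ∈ T, t + a ∉ T) (hTb : ∀ t ∈ T, t + b ∉ T)
    (h1 : ∀ v, (switchGraph a b T).Reachable 0 v) (h2 : ∀ v, (switchGraph b a T).Reachable 0 v) :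
    HamiltonCovered ({a, -a, b, -b} : Set (ZMod m)) := by
  have ha : a ≠ 0 := by rintro rfl; simp at haa
  have hb : b ≠ 0 := by rintro rfl; simp at hbb
  have hba' : b ≠ -a := fun h => hab' (by rw [h, neg_neg])
  obtain ⟨c, hc⟩ := exists_cycle_of_connected hm (switchGraph a b T)
    ⟨fun u v => (h1 u).symm.trans (h1 v)⟩ (switchGraph_ncard haa hbb hab hab' hTa hTb)
  obtain ⟨c', hc'⟩ := exists_cycle_of_connected hm (switchGraph b a T)
    ⟨fun u v => (h2 u).symm.trans (h2 v)⟩ (switchGraph_ncard hbb haa hab.symm hba' hTb hTa)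
  refine hamiltonCovered_of_two_cycles haa hbb hab hab' c c' (fun u => ?_) (fun u => ?_)
  · by_cases h : u ∈ T ∨ u - b ∈ T
    · exact Or.inr (hc' _ _ (switchGraph_adj_snd ha h))
    · rw [not_or] at h
      exact Or.inl (hc _ _ (switchGraph_adj_fst ha h.1 h.2))
  · by_cases h : u ∈ T ∨ u - a ∈ T
    · exact Or.inl (hc _ _ (switchGraph_adj_snd hb h))
    · rw [not_or] at h
      exact Or.inr (hc' _ _ (switchGraph_adj_fst hb h.1 h.2))

/-! ### Connectedness of the rows -/

theorem ZMod.eq_of_natCast_eq {n i j : ℕ} (hi : i < n) (hj : j < n) (h : (i : ZMod n) = j) :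
    i = j := by
  rwa [ZMod.natCast_eq_natCast_iff', Nat.mod_eq_of_lt hi, Nat.mod_eq_of_lt hj] at h

/-- The vertex in column `x` and row `j` of the grid spanned by `a` and `b`. -/
def gridPoint {m : ℕ} (a b : ZMod m) (x j : ℕ) : ZMod m := x * a + j * b

/-- The column of the switch in row `j`: a staircase up to column `z`, from then on alternating
between the columns `z` and `z + 1`. -/
def switchColumn (z j : ℕ) : ℕ := if j < z then j else z + (j - z) % 2

/-- The set of switches: one between the rows `j` and `j + 1` for each `j < g - 1`. -/
def switchSet {m : ℕ} (a b : ZMod m) (g z : ℕ) : Set (ZMod m) :=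
  {v | ∃ j, j + 1 < g ∧ v = gridPoint a b (switchColumn z j) j}

theorem switchColumn_le (z j : ℕ) : switchColumn z j ≤ z + 1 := by
  unfold switchColumn; split_ifs <;> omega

theorem switchColumn_succ_ne (z j : ℕ) : switchColumn z (j + 1) ≠ switchColumn z j := by
  unfold switchColumn; split_ifs <;> omega

theorem gridPoint_add_fst {m : ℕ} (a b : ZMod m) (x j : ℕ) :
    gridPoint a b x j + a = gridPoint a b (x + 1) j := by
  simp only [gridPoint]; push_cast; ring

theorem gridPoint_add_snd {m : ℕ} (a b : ZMod m) (x j : ℕ) :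
    gridPoint a b x j + b = gridPoint a b x (j + 1) := by
  simp only [gridPoint]; push_cast; ring

/-- In a cyclic sequence of vertices `w, w + s, w + 2 * s, …` a single missing edge does not
disconnect. -/
theorem reachable_of_walk {m : ℕ} [NeZero m] {G : SimpleGraph (ZMod m)} {w s : ZMod m}
    (h : ∀ n : ℕ, w + n * s ≠ w → G.Reachable (w + n * s) (w + n * s + s)) (n : ℕ) :
    G.Reachable w (w + n * s) := by
  have h1 : ∀ n : ℕ, G.Reachable (w + s) (w + s + n * s) := by
    intro n
    induction n with
    | zero => simp
    | succ n ih =>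
      by_cases hn : w + (n + 1 : ℕ) * s = w
      · have : w + s + (n + 1 : ℕ) * s = w + s := by linear_combination hn
        rw [this]
      · have h2 := h _ hn
        have e1 : w + (n + 1 : ℕ) * s = w + s + n * s := by push_cast; ring
        have e2 : w + s + (n + 1 : ℕ) * s = w + s + n * s + s := by push_cast; ring
        rw [e2]
        rw [e1] at h2
        exact ih.trans h2
  have h2 : G.Reachable (w + s) w := by
    have h3 := h1 (m - 1)
    have : w + s + (m - 1 : ℕ) * s = w := by
      rw [Nat.cast_sub (NeZero.one_le), ZMod.natCast_self]; push_cast; ring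
    rwa [this] at h3
  cases n with
  | zero => simp
  | succ n =>
    have := h2.symm.trans (h1 n)
    rwa [show w + s + n * s = w + (n + 1 : ℕ) * s by push_cast; ring] at this

/-- If each step `s` stays in a component, so do all its multiples. -/
theorem reachable_add_mul {m : ℕ} {G : SimpleGraph (ZMod m)} {s : ZMod m}
    (h : ∀ w, G.Reachable w (w + s)) (w : ZMod m) (n : ℕ) : G.Reachable w (w + n * s) := by
  induction n with
  | zero => simp
  | succ n ih =>
    rw [show w + (n + 1 : ℕ) * s = w + n * s + s by push_cast; ring]
    exact ih.trans (h _)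

/-- The rows (cosets of `a`) are merged one after the other by the switches. -/
theorem switchGraph_rows_reachable {m : ℕ} [NeZero m] {a b : ZMod m} {g z : ℕ} (ha : a ≠ 0)
    (hb : b ≠ 0)
    (hrow : ∀ v : ZMod m, ∃ j n : ℕ, j < g ∧ v = n * a + j * b)
    (hrow_inj : ∀ j j' n n' : ℕ, j < g → j' < g →
      (n * a + j * b : ZMod m) = n' * a + j' * b → j = j') (v : ZMod m) :
    (switchGraph a b (switchSet a b g z)).Reachable 0 v := by
  set T := switchSet a b g z with hT
  set G := switchGraph a b T with hG
  have hTm : ∀ j, j + 1 < g → gridPoint a b (switchColumn z j) j ∈ T := fun j hj => ⟨j, hj, rfl⟩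
  have hv1 : ∀ t ∈ T, G.Reachable t (t + b) := fun t ht =>
    (switchGraph_adj_snd hb (Or.inl ht)).reachable
  have hv2 : ∀ t ∈ T, G.Reachable (t + a) (t + a + b) := fun t ht =>
    (switchGraph_adj_snd hb (Or.inr (by simpa using ht))).reachable
  have hP : ∀ d j, j + 2 + d = g → G.Reachable (gridPoint a b (switchColumn z j) j)
      (gridPoint a b (switchColumn z j) j + a) := by
    intro d
    induction d with
    | zero | succ d ih =>
      intro j hj
      have hjT := hTm j (by omega)
      set t := gridPoint a b (switchColumn z j) j with ht
      -- the row of `t + b` can be traversed the long way round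
      have hwalk := reachable_of_walk (G := G) (w := t + b) (s := a) (fun n hn => by
        have hform : t + b + n * a = ((switchColumn z j + n : ℕ) : ZMod m) * a
            + ((j + 1 : ℕ) : ZMod m) * b := by
          rw [ht, gridPoint]; push_cast; ring
        by_cases h1 : t + b + n * a ∈ T
        · obtain ⟨i, hi, h⟩ := h1
          have hij : j + 1 = i := hrow_inj _ _ _ _ (by omega) (by omega) (hform.symm.trans h)
          subst hij
          first
            | omega
            | rw [h]
              exact ih (j + 1) (by omega)
        · by_cases h2 : t + b + n * a - b ∈ T
          · obtain ⟨i, hi, h⟩ := h2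
            have h' : t + b + n * a = gridPoint a b (switchColumn z i) (i + 1) := by
              rw [← gridPoint_add_snd, ← h]; ring
            have hij : j + 1 = i + 1 :=
              hrow_inj _ _ _ _ (by omega) (by omega) (hform.symm.trans h')
            have hij' : j = i := by omega
            subst hij'
            rw [← gridPoint_add_snd] at h'
            exact absurd h' hn
          · exact (switchGraph_adj_fst ha h1 h2).reachable) 1
      have h3 := (hv1 t hjT).trans hwalk
      rw [show t + b + (1 : ℕ) * a = t + a + b by push_cast; ring] at h3
      exact h3.trans (hv2 t hjT).symm
  have hTa : ∀ t ∈ T, G.Reachable t (t + a) := by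
    rintro _ ⟨j, hj, rfl⟩
    exact hP (g - 2 - j) j (by omega)
  have hstep : ∀ w, G.Reachable w (w + a) := by
    intro w
    by_cases h1 : w ∈ T
    · exact hTa w h1
    · by_cases h2 : w - b ∈ T
      · have := ((hv1 _ h2).symm.trans (hTa _ h2)).trans (hv2 _ h2)
        rwa [show w - b + a + b = w + a by ring, sub_add_cancel] at this
      · exact (switchGraph_adj_fst ha h1 h2).reachable
  have hrows : ∀ j : ℕ, j < g → G.Reachable 0 (j * b) := by
    intro j
    induction j with
    | zero => intro _; simp
    | succ j ih =>
      intro hj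
      have h1 := reachable_add_mul hstep (j * b) (switchColumn z j)
      have h2 := reachable_add_mul hstep ((j + 1 : ℕ) * b) (switchColumn z j)
      have h3 := hv1 _ (hTm j hj)
      rw [gridPoint_add_snd] at h3
      simp only [gridPoint] at h3
      rw [add_comm ((j : ZMod m) * b)] at h1
      rw [add_comm (((j + 1 : ℕ) : ZMod m) * b)] at h2
      exact (((ih (by omega)).trans h1).trans h3).trans h2.symm
  obtain ⟨j, n, hj, rfl⟩ := hrow v
  rw [add_comm]
  exact (hrows j hj).trans (reachable_add_mul hstep _ n)

/-! ### Connectedness of the columns -/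

/-- The standing assumptions on the grid spanned by `a` and `b` with `g` rows, whose switches
alternate from column `z` on: the vertices in the rows `0, …, g - 1` and in the columns
`0, …, z + 2` are distinct. -/
structure IsSwitchGrid {m : ℕ} (a b : ZMod m) (g z : ℕ) : Prop where
  fst_ne : a ≠ 0
  snd_ne : b ≠ 0
  even : Even z
  odd : Odd g
  le : z + 3 ≤ g
  inj : ∀ x x' j j' : ℕ, x ≤ z + 2 → x' ≤ z + 2 → j < g → j' < g →
    gridPoint a b x j = gridPoint a b x' j' → x = x' ∧ j = j'

namespace IsSwitchGrid

variable {m : ℕ} {a b : ZMod m} {g z : ℕ}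

theorem add_fst_notMem (h : IsSwitchGrid a b g z) :
    ∀ t ∈ switchSet a b g z, t + a ∉ switchSet a b g z := by
  rintro _ ⟨j, hj, rfl⟩ ⟨i, hi, hij⟩
  rw [gridPoint_add_fst] at hij
  have h1 := switchColumn_le z j
  have h2 := switchColumn_le z i
  obtain ⟨h3, rfl⟩ := h.inj _ _ _ _ (by omega) (by omega) (by omega) (by omega) hij
  omega

theorem add_snd_notMem (h : IsSwitchGrid a b g z) :
    ∀ t ∈ switchSet a b g z, t + b ∉ switchSet a b g z := by
  rintro _ ⟨j, hj, rfl⟩ ⟨i, hi, hij⟩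
  rw [gridPoint_add_snd] at hij
  have h1 := switchColumn_le z j
  have h2 := switchColumn_le z i
  obtain ⟨h3, rfl⟩ := h.inj _ _ _ _ (by omega) (by omega) (by omega) (by omega) hij
  exact switchColumn_succ_ne z j h3.symm

theorem reachable_horizontal (h : IsSwitchGrid a b g z) {j : ℕ} (hj : j + 1 < g) :
    (switchGraph b a (switchSet a b g z)).Reachable (gridPoint a b (switchColumn z j) j)
      (gridPoint a b (switchColumn z j + 1) j) := by
  rw [← gridPoint_add_fst]
  exact (switchGraph_adj_snd (T := switchSet a b g z) h.fst_ne (Or.inl ⟨j, hj, rfl⟩)).reachable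

theorem reachable_horizontal_succ (h : IsSwitchGrid a b g z) {j : ℕ} (hj : j + 1 < g) :
    (switchGraph b a (switchSet a b g z)).Reachable (gridPoint a b (switchColumn z j) (j + 1))
      (gridPoint a b (switchColumn z j + 1) (j + 1)) := by
  rw [← gridPoint_add_fst]
  refine (switchGraph_adj_snd (T := switchSet a b g z) h.fst_ne (Or.inr ⟨j, hj, ?_⟩)).reachable
  rw [← gridPoint_add_snd]
  ring

theorem reachable_vertical (h : IsSwitchGrid a b g z) {x j : ℕ} (hx : x ≤ z + 2) (hj : j + 1 < g)
    (h1 : x ≠ switchColumn z j) (h2 : x ≠ switchColumn z j + 1) :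
    (switchGraph b a (switchSet a b g z)).Reachable (gridPoint a b x j)
      (gridPoint a b x (j + 1)) := by
  rw [← gridPoint_add_snd]
  refine (switchGraph_adj_fst h.snd_ne ?_ ?_).reachable
  · rintro ⟨i, hi, hij⟩
    have h3 := switchColumn_le z i
    obtain ⟨h4, rfl⟩ := h.inj _ _ _ _ hx (by omega) (by omega) (by omega) hij
    exact h1 h4
  · rintro ⟨i, hi, hij⟩
    have h3 := switchColumn_le z i
    rw [sub_eq_iff_eq_add, gridPoint_add_fst] at hij
    obtain ⟨h4, rfl⟩ := h.inj _ _ _ _ hx (by omega) (by omega) (by omega) hij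
    exact h2 h4

/-- The two vertical edges removed by one switch have their ends in the same components. -/
theorem reachable_vertical_iff (h : IsSwitchGrid a b g z) {j : ℕ} (hj : j + 1 < g) :
    (switchGraph b a (switchSet a b g z)).Reachable (gridPoint a b (switchColumn z j) j)
      (gridPoint a b (switchColumn z j) (j + 1)) ↔
    (switchGraph b a (switchSet a b g z)).Reachable (gridPoint a b (switchColumn z j + 1) j)
      (gridPoint a b (switchColumn z j + 1) (j + 1)) :=
  ⟨fun h1 => ((h.reachable_horizontal hj).symm.trans h1).trans (h.reachable_horizontal_succ hj),
   fun h1 => ((h.reachable_horizontal hj).trans h1).trans (h.reachable_horizontal_succ hj).symm⟩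

theorem switchColumn_of_even {z j : ℕ} (hz : Even z) (hzj : z ≤ j) (hj : Even j) :
    switchColumn z j = z := by
  obtain ⟨p, rfl⟩ := hz
  obtain ⟨q, rfl⟩ := hj
  unfold switchColumn; split_ifs <;> omega

theorem switchColumn_of_odd {z j : ℕ} (hz : Even z) (hzj : z ≤ j) (hj : Odd j) :
    switchColumn z j = z + 1 := by
  obtain ⟨p, rfl⟩ := hz
  obtain ⟨q, rfl⟩ := hj
  unfold switchColumn; split_ifs <;> omega

/-- In a row between two alternating switches, the three columns `z`, `z + 1`, `z + 2` are joined
by horizontal edges. -/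
theorem reachable_row (h : IsSwitchGrid a b g z) {j : ℕ} (hzj : z ≤ j) (hj : j + 2 < g) :
    (switchGraph b a (switchSet a b g z)).Reachable (gridPoint a b z (j + 1))
      (gridPoint a b (z + 1) (j + 1)) ∧
    (switchGraph b a (switchSet a b g z)).Reachable (gridPoint a b z (j + 1))
      (gridPoint a b (z + 2) (j + 1)) := by
  have h1 := h.reachable_horizontal_succ (j := j) (by omega)
  have h2 := h.reachable_horizontal (j := j + 1) (by omega)
  rcases Nat.even_or_odd j with he | ho
  · rw [switchColumn_of_even h.even hzj he] at h1
    rw [switchColumn_of_odd h.even (by omega) he.add_one] at h2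
    exact ⟨h1, h1.trans h2⟩
  · rw [switchColumn_of_odd h.even hzj ho] at h1
    rw [switchColumn_of_even h.even (by omega) ho.add_one] at h2
    exact ⟨h2, h2.trans h1⟩

theorem reachable_snake (h : IsSwitchGrid a b g z) :
    ∀ d, z + d + 2 < g → ∀ x, z ≤ x → x ≤ z + 2 →
    (switchGraph b a (switchSet a b g z)).Reachable (gridPoint a b z (z + 1))
      (gridPoint a b x (z + d + 1)) := by
  have hrow : ∀ j x, z ≤ j → j + 2 < g → z ≤ x → x ≤ z + 2 →
      (switchGraph b a (switchSet a b g z)).Reachable (gridPoint a b z (j + 1))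
        (gridPoint a b x (j + 1)) := by
    intro j x hzj hj hx hx'
    obtain ⟨h1, h2⟩ := h.reachable_row hzj hj
    obtain rfl | rfl | rfl : x = z ∨ x = z + 1 ∨ x = z + 2 := by omega
    · exact .refl _
    · exact h1
    · exact h2
  intro d
  induction d with
  | zero => intro hg x hx hx'; exact hrow z x le_rfl hg hx hx'
  | succ d ih =>
    intro hg x hx hx'
    -- one of the outer columns climbs from the previous row
    have hup : ∃ y, z ≤ y ∧ y ≤ z + 2 ∧ (switchGraph b a (switchSet a b g z)).Reachable
        (gridPoint a b y (z + d + 1)) (gridPoint a b y (z + d + 1 + 1)) := by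
      rcases Nat.even_or_odd (z + d + 1) with he | ho
      · have := switchColumn_of_even h.even (by omega) he
        exact ⟨z + 2, by omega, by omega,
          h.reachable_vertical (by omega) (by omega) (by omega) (by omega)⟩
      · have := switchColumn_of_odd h.even (by omega) ho
        exact ⟨z, by omega, by omega,
          h.reachable_vertical (by omega) (by omega) (by omega) (by omega)⟩
    obtain ⟨y, hy, hy', h1⟩ := hup
    exact ((ih (by omega) y hy hy').trans h1).trans
      ((hrow (z + d + 1) y (by omega) (by omega) hy hy').symm.trans
        (hrow (z + d + 1) x (by omega) (by omega) hx hx'))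

/-- The part of the columns `z`, `z + 1`, `z + 2` strictly between the rows `z` and `g - 1` is
traversed like a snake, row after row. -/
theorem reachable_base (h : IsSwitchGrid a b g z) {x j : ℕ} (hx : z ≤ x) (hx' : x ≤ z + 2)
    (hj : z + 1 ≤ j) (hj' : j + 1 < g) :
    (switchGraph b a (switchSet a b g z)).Reachable (gridPoint a b z (z + 1))
      (gridPoint a b x j) := by
  have := h.reachable_snake (j - (z + 1)) (by omega) x hx hx'
  rwa [show z + (j - (z + 1)) + 1 = j by omega] at this

theorem reachable_base_bottom (h : IsSwitchGrid a b g z) :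
    (switchGraph b a (switchSet a b g z)).Reachable (gridPoint a b z (z + 1))
      (gridPoint a b (z + 2) z) := by
  have hg := h.le
  have h1 := switchColumn_of_even h.even le_rfl h.even
  exact (h.reachable_base (by omega) le_rfl le_rfl (by omega)).trans
    (h.reachable_vertical (x := z + 2) (j := z) le_rfl (by omega) (by omega) (by omega)).symm

theorem switchColumn_last (h : IsSwitchGrid a b g z) : switchColumn z (g - 2) = z + 1 := by
  have hg := h.le
  refine switchColumn_of_odd h.even (by omega) ?_
  obtain ⟨p, hp⟩ := h.odd
  exact ⟨p - 1, by omega⟩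

theorem reachable_base_top (h : IsSwitchGrid a b g z) :
    (switchGraph b a (switchSet a b g z)).Reachable (gridPoint a b z (z + 1))
      (gridPoint a b z (g - 1)) := by
  have hg := h.le
  have h1 := h.switchColumn_last
  have h2 := h.reachable_vertical (x := z) (j := g - 2) (by omega) (by omega) (by omega) (by omega)
  rw [show g - 2 + 1 = g - 1 by omega] at h2
  exact (h.reachable_base le_rfl (by omega) (by omega) (by omega)).trans h2

/-- If no switch separates the ends of the vertical edges which it removes, then the columns are
connected. -/
theorem reachable_add_snd (h : IsSwitchGrid a b g z)
    (hv : ∀ j, j + 1 < g →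
      (switchGraph b a (switchSet a b g z)).Reachable (gridPoint a b (switchColumn z j) j)
        (gridPoint a b (switchColumn z j) (j + 1))) (w : ZMod m) :
    (switchGraph b a (switchSet a b g z)).Reachable w (w + b) := by
  by_cases h1 : w ∈ switchSet a b g z
  · obtain ⟨j, hj, rfl⟩ := h1
    rw [gridPoint_add_snd]
    exact hv j hj
  · by_cases h2 : w - a ∈ switchSet a b g z
    · obtain ⟨j, hj, h3⟩ := h2
      rw [sub_eq_iff_eq_add, gridPoint_add_fst] at h3
      subst h3
      rw [gridPoint_add_snd]
      exact (h.reachable_vertical_iff hj).1 (hv j hj)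
    · exact (switchGraph_adj_fst h.snd_ne h1 h2).reachable

/-- In a column, all edges other than one given edge may be used, provided the ends of the other
removed vertical edges are known to be connected. -/
theorem reachable_column [NeZero m] (h : IsSwitchGrid a b g z)
    (hcol : ∀ x x' n n' : ℕ, x ≤ z + 2 → x' ≤ z + 2 →
      gridPoint a b x n = gridPoint a b x' n' → x = x') {x j : ℕ} (hx : x ≤ z + 2)
    (h1 : ∀ i, i + 1 < g → x = switchColumn z i → i ≠ j →
      (switchGraph b a (switchSet a b g z)).Reachable (gridPoint a b x i)
        (gridPoint a b x (i + 1)))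
    (h2 : ∀ i, i + 1 < g → x = switchColumn z i + 1 → i ≠ j →
      (switchGraph b a (switchSet a b g z)).Reachable (gridPoint a b x i)
        (gridPoint a b x (i + 1))) :
    (switchGraph b a (switchSet a b g z)).Reachable (gridPoint a b x j)
        (gridPoint a b x (j + 1)) := by
  have hw := reachable_of_walk (G := switchGraph b a (switchSet a b g z))
    (w := gridPoint a b x j) (s := b) (fun n hn => by
      have hform : gridPoint a b x j + n * b = gridPoint a b x (j + n) := by
        simp only [gridPoint]; push_cast; ring
      rw [hform] at hn ⊢
      by_cases h3 : gridPoint a b x (j + n) ∈ switchSet a b g z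
      · obtain ⟨i, hi, h4⟩ := h3
        have h5 := switchColumn_le z i
        have h6 := hcol _ _ _ _ hx (by omega) h4
        rw [← h6] at h4
        rw [h4, gridPoint_add_snd]
        refine h1 i hi h6 ?_
        rintro rfl
        exact hn h4
      · by_cases h4 : gridPoint a b x (j + n) - a ∈ switchSet a b g z
        · obtain ⟨i, hi, h4⟩ := h4
          rw [sub_eq_iff_eq_add, gridPoint_add_fst] at h4
          have h5 := switchColumn_le z i
          have h6 := hcol _ _ _ _ hx (by omega) h4
          rw [← h6] at h4
          rw [h4, gridPoint_add_snd]
          refine h2 i hi h6 ?_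
          rintro rfl
          exact hn h4
        · exact (switchGraph_adj_fst h.snd_ne h3 h4).reachable) 1
  rwa [Nat.cast_one, one_mul, gridPoint_add_snd] at hw

/-- Several columns (cosets of `b`): the staircase of switches merges the columns `0, …, z` one
after the other, the snake merges the last two. -/
theorem columns_reachable [NeZero m] (h : IsSwitchGrid a b g z)
    (hcol : ∀ v : ZMod m, ∃ x n : ℕ, x ≤ z + 2 ∧ v = gridPoint a b x n)
    (hcol_inj : ∀ x x' n n' : ℕ, x ≤ z + 2 → x' ≤ z + 2 →
      gridPoint a b x n = gridPoint a b x' n' → x = x') (v : ZMod m) :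
    (switchGraph b a (switchSet a b g z)).Reachable 0 v := by
  have hg := h.le
  have hlast := h.switchColumn_last
  set G := switchGraph b a (switchSet a b g z) with hG
  have hlt : ∀ i, i < z → switchColumn z i = i := fun i hi => if_pos hi
  have hge : ∀ i, z ≤ i → z ≤ switchColumn z i := by
    intro i hi
    rcases Nat.even_or_odd i with he | ho
    · rw [switchColumn_of_even h.even hi he]
    · rw [switchColumn_of_odd h.even hi ho]; omega
  have hz := switchColumn_of_even h.even le_rfl h.even
  -- inside the snake nothing is separated
  have hK : ∀ x i, z ≤ x → x ≤ z + 2 → z + 1 ≤ i → i + 2 < g →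
      G.Reachable (gridPoint a b x i) (gridPoint a b x (i + 1)) := fun x i hx hx' hi hi' =>
    (h.reachable_base hx hx' hi (by omega)).symm.trans
      (h.reachable_base hx hx' (by omega) (by omega))
  have hstair : ∀ j, j < z → G.Reachable (gridPoint a b j j) (gridPoint a b j (j + 1)) := by
    intro j
    induction j using Nat.strong_induction_on with
    | _ j ih =>
      intro hj
      refine h.reachable_column hcol_inj (by omega) (fun i hi hji hij => ?_) fun i hi hji hij => ?_
      · rcases lt_or_ge i z with hiz | hiz
        · rw [hlt i hiz] at hji; omega
        · have := hge i hiz; omega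
      · rcases lt_or_ge i z with hiz | hiz
        · have h1 := ih i (by rw [hlt i hiz] at hji; omega) hiz
          rw [hji]
          refine (h.reachable_vertical_iff hi).1 ?_
          rwa [hlt i hiz]
        · have := hge i hiz; omega
  have hcz : G.Reachable (gridPoint a b z z) (gridPoint a b z (z + 1)) := by
    refine h.reachable_column hcol_inj (by omega) (fun i hi hji hij => ?_) fun i hi hji hij => ?_
    · rcases lt_or_ge i z with hiz | hiz
      · rw [hlt i hiz] at hji; omega
      · have hi2 : i ≠ g - 2 := by rintro rfl; omega
        exact hK z i le_rfl (by omega) (by omega) (by omega)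
    · rcases lt_or_ge i z with hiz | hiz
      · have h3 := (h.reachable_vertical_iff hi).1 (by rw [hlt i hiz]; exact hstair i hiz)
        rwa [← hji] at h3
      · have := hge i hiz; omega
  have hcz1 : G.Reachable (gridPoint a b (z + 1) (g - 2))
      (gridPoint a b (z + 1) (g - 2 + 1)) := by
    refine h.reachable_column hcol_inj (by omega) (fun i hi hji hij => ?_) fun i hi hji hij => ?_
    · rcases lt_or_ge i z with hiz | hiz
      · rw [hlt i hiz] at hji; omega
      · have hi2 : i ≠ z := by rintro rfl; omega
        exact hK _ i (by omega) (by omega) (by omega) (by omega)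
    · rcases lt_or_ge i z with hiz | hiz
      · rw [hlt i hiz] at hji; omega
      · by_cases hi2 : i = z
        · subst hi2
          have := (h.reachable_vertical_iff hi).1
          rw [hz] at this
          exact this hcz
        · exact hK _ i (by omega) (by omega) (by omega) (by omega)
  have hv : ∀ j, j + 1 < g → G.Reachable (gridPoint a b (switchColumn z j) j)
      (gridPoint a b (switchColumn z j) (j + 1)) := by
    intro j hj
    rcases lt_trichotomy j z with hjz | rfl | hjz
    · rw [hlt j hjz]; exact hstair j hjz
    · rw [hz]; exact hcz
    · by_cases hj2 : j = g - 2
      · subst hj2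
        rw [hlast]
        exact hcz1
      · have := switchColumn_le z j
        exact hK _ j (hge j hjz.le) (by omega) (by omega) (by omega)
  have hstep := h.reachable_add_snd hv
  have hcol0 : ∀ x n : ℕ, G.Reachable (gridPoint a b x 0) (gridPoint a b x n) := by
    intro x n
    have := reachable_add_mul hstep (gridPoint a b x 0) n
    rwa [show gridPoint a b x 0 + n * b = gridPoint a b x n by
      simp only [gridPoint]; push_cast; ring] at this
  have hcols : ∀ x : ℕ, x ≤ z + 2 → G.Reachable 0 (gridPoint a b x 0) := by
    intro x
    induction x with
    | zero => intro _; rw [show gridPoint a b 0 0 = 0 by simp [gridPoint]]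
    | succ x ih =>
      intro hx
      have hx' : switchColumn z x = x := by
        rcases lt_trichotomy x z with h1 | rfl | h1
        · exact hlt x h1
        · exact hz
        · obtain rfl : x = z + 1 := by omega
          exact switchColumn_of_odd h.even (by omega) h.even.add_one
      have h1 := h.reachable_horizontal (j := x) (by omega)
      rw [hx'] at h1
      exact (((ih (by omega)).trans (hcol0 x x)).trans h1).trans (hcol0 (x + 1) x).symm
  obtain ⟨x, n, hx, rfl⟩ := hcol v
  exact (hcols x hx).trans (hcol0 x n)

/-- A single column: `b = 1` generates, and `a` is less than half the order. -/
theorem single_column_reachable [NeZero m] {A : ℕ} (h : IsSwitchGrid (A : ZMod m) 1 g 0)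
    (hgA : g ≤ A) (hA : 2 * A + g ≤ m) (v : ZMod m) :
    (switchGraph 1 (A : ZMod m) (switchSet (A : ZMod m) 1 g 0)).Reachable 0 v := by
  have hg := h.le
  have hlast := h.switchColumn_last
  set G := switchGraph 1 (A : ZMod m) (switchSet (A : ZMod m) 1 g 0) with hG
  have hpt : ∀ x j : ℕ, gridPoint (A : ZMod m) 1 x j = ((x * A + j : ℕ) : ZMod m) := by
    intro x j; simp [gridPoint]
  have hlinear : ∀ x ≤ 2, ∀ j < g, x * A + j < m := by
    intro x hx j hj
    have : x * A ≤ 2 * A := Nat.mul_le_mul_right A hx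
    omega
  -- outside the rows of the switches the vertical edges are untouched
  have hfree : ∀ i < m, (∀ x ≤ 2, ∀ j, j + 1 < g → i ≠ x * A + j) →
      G.Reachable (i : ZMod m) ((i + 1 : ℕ) : ZMod m) := by
    intro i hi hne
    rw [Nat.cast_add_one]
    refine (switchGraph_adj_fst h.snd_ne ?_ ?_).reachable
    · rintro ⟨j, hj, h1⟩
      have := switchColumn_le 0 j
      rw [hpt] at h1
      exact hne _ (by omega) j hj (ZMod.eq_of_natCast_eq hi (hlinear _ (by omega) _ (by omega)) h1)
    · rintro ⟨j, hj, h1⟩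
      have := switchColumn_le 0 j
      rw [sub_eq_iff_eq_add, gridPoint_add_fst, hpt] at h1
      exact hne _ (by omega) j hj (ZMod.eq_of_natCast_eq hi (hlinear _ (by omega) _ (by omega)) h1)
  have hrun : ∀ s e : ℕ, s ≤ e → e ≤ m → (∀ i, s ≤ i → i < e → ∀ x ≤ 2, ∀ j, j + 1 < g →
      i ≠ x * A + j) → G.Reachable (s : ZMod m) (e : ZMod m) := by
    intro s e hse
    induction e, hse using Nat.le_induction with
    | base => intro _ _; exact .refl _
    | succ e hse ih =>
      intro hem hne
      exact (ih (by omega) fun i hi hi' => hne i hi (by omega)).trans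
        (hfree e (by omega) (hne e hse (by omega)))
  have hx3 : ∀ x ≤ 2, x * A = 0 ∨ x * A = A ∨ x * A = 2 * A := by
    intro x hx
    interval_cases x <;> simp
  have h01 : G.Reachable (gridPoint (A : ZMod m) 1 0 (g - 1)) (gridPoint (A : ZMod m) 1 1 0) := by
    rw [hpt, hpt]
    refine hrun _ _ (by omega) (by omega) fun i hi hi' x hx j hj => ?_
    have := hx3 x hx
    omega
  have h12 : G.Reachable (gridPoint (A : ZMod m) 1 1 (g - 1)) (gridPoint (A : ZMod m) 1 2 0) := by
    rw [hpt, hpt]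
    refine hrun _ _ (by omega) (by omega) fun i hi hi' x hx j hj => ?_
    have := hx3 x hx
    omega
  have hv : ∀ j, j + 1 < g → G.Reachable (gridPoint (A : ZMod m) 1 (switchColumn 0 j) j)
      (gridPoint (A : ZMod m) 1 (switchColumn 0 j) (j + 1)) := by
    intro j hj
    have hc := switchColumn_le 0 j
    by_cases hj0 : j = 0
    · subst hj0
      have h0 := h.reachable_horizontal hj
      rw [show switchColumn 0 0 = 0 from rfl] at h0 ⊢
      exact ((h0.trans h01.symm).trans h.reachable_base_top.symm)
    · by_cases hj2 : j = g - 2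
      · subst hj2
        rw [hlast, show g - 2 + 1 = g - 1 by omega]
        exact ((h.reachable_base (by omega) (by omega) (by omega) (by omega)).symm.trans
          h.reachable_base_bottom).trans h12.symm
      · exact (h.reachable_base (by omega) (by omega) (by omega) (by omega)).symm.trans
          (h.reachable_base (by omega) (by omega) (by omega) (by omega))
  have := reachable_add_mul (h.reachable_add_snd hv) 0 v.val
  rwa [zero_add, mul_one, ZMod.natCast_zmod_val] at this

end IsSwitchGrid

/-! ### Two consecutive differences -/

theorem ZMod.ne_neg_of_odd {m : ℕ} (hm : Odd m) {a : ZMod m} (ha : a ≠ 0) : a ≠ -a := by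
  obtain ⟨k, rfl⟩ := hm
  intro h
  apply ha
  have h1 : (2 : ZMod (2 * k + 1)) * a = 0 := by linear_combination h
  have h2 : ((2 * k + 1 : ℕ) : ZMod (2 * k + 1)) = 0 := ZMod.natCast_self _
  push_cast at h2
  linear_combination a * h2 - k * h1

/-- The multiples of `a` in `ZMod m` are the kernel of a reduction `ZMod m → ZMod g`, and `1 < g`
unless `a` is a unit. -/
theorem exists_reduction {m : ℕ} [NeZero m] (a : ZMod m) :
    ∃ g : ℕ, g ∣ m ∧ (¬ IsUnit a → g ≠ 1) ∧ g ∣ a.val ∧ ∃ f : ZMod m →+* ZMod g, f a = 0 ∧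
      ∀ v, f v = 0 → ∃ n : ℕ, v = n * a := by
  set g := Nat.gcd a.val m with hg
  have hgm : g ∣ m := Nat.gcd_dvd_right _ _
  have hga : g ∣ a.val := Nat.gcd_dvd_left _ _
  refine ⟨g, hgm, ?_, hga, ZMod.castHom hgm (ZMod g), ?_, ?_⟩
  · intro h h1
    apply h
    rw [← ZMod.natCast_zmod_val a]
    exact (ZMod.isUnit_iff_coprime _ _).2 h1
  · rw [← ZMod.natCast_zmod_val a, map_natCast]
    exact (ZMod.natCast_eq_zero_iff _ _).2 hga
  · intro v hv
    rw [← ZMod.natCast_zmod_val v, map_natCast, ZMod.natCast_eq_zero_iff] at hv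
    obtain ⟨c, hc⟩ := hv
    have h1 := Nat.gcd_eq_gcd_ab a.val m
    rw [← hg] at h1
    have h2 := congrArg (Int.cast : ℤ → ZMod m) h1
    push_cast at h2
    rw [ZMod.natCast_self, zero_mul, add_zero, ZMod.natCast_zmod_val] at h2
    refine ⟨(((Nat.gcdA a.val m * c : ℤ)) : ZMod m).val, ?_⟩
    rw [ZMod.natCast_zmod_val, ← ZMod.natCast_zmod_val v, hc]
    push_cast
    rw [h2]
    ring

/-- Two directions neither of which generates: both families of cosets consist of several rows or
columns of the grid. -/
theorem hamiltonCovered_of_reductions {m g h : ℕ} [NeZero m] (hodd : Odd m) (hgm : g ∣ m)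
    (hhm : h ∣ m) (h3 : 3 ≤ h) (hgh : h < g) {a : ZMod m} (ha' : a ≠ -(a + 1))
    (f : ZMod m →+* ZMod g) (hf : f a = 0) (hfk : ∀ v, f v = 0 → ∃ n : ℕ, v = n * a)
    (f' : ZMod m →+* ZMod h) (hf' : f' (a + 1) = 0)
    (hfk' : ∀ v, f' v = 0 → ∃ n : ℕ, v = n * (a + 1)) :
    HamiltonCovered ({a, -a, a + 1, -(a + 1)} : Set (ZMod m)) := by
  have : NeZero g := ⟨by omega⟩
  have : NeZero h := ⟨by omega⟩
  have : Fact (1 < g) := ⟨by omega⟩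
  have : Fact (1 < h) := ⟨by omega⟩
  have hm3 : 3 ≤ m := h3.trans (Nat.le_of_dvd (NeZero.pos m) hhm)
  have : Fact (1 < m) := ⟨by omega⟩
  have hgo : Odd g := hodd.of_dvd_nat hgm
  have hho : Odd h := hodd.of_dvd_nat hhm
  have hfb : f (a + 1) = 1 := by rw [map_add, hf, map_one, zero_add]
  have hfa' : f' a = -1 := by
    rw [map_add, map_one] at hf'
    linear_combination hf'
  have ha : a ≠ 0 := by rintro rfl; simp at hfa'
  have hb : a + 1 ≠ 0 := by intro h; rw [h] at hfb; simp at hfb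
  have hrow : ∀ v : ZMod m, ∃ j n : ℕ, j < g ∧ v = n * a + j * (a + 1) := by
    intro v
    obtain ⟨n, hn⟩ := hfk (v - (f v).val * (a + 1)) (by
      rw [map_sub, map_mul, map_natCast, hfb, ZMod.natCast_zmod_val]; ring)
    exact ⟨(f v).val, n, ZMod.val_lt _, by rw [← hn]; ring⟩
  have hrow_inj : ∀ j j' n n' : ℕ, j < g → j' < g →
      (n * a + j * (a + 1) : ZMod m) = n' * a + j' * (a + 1) → j = j' := by
    intro j j' n n' hj hj' he
    have := congrArg f he
    simp only [map_add, map_mul, map_natCast, hf, map_one] at this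
    exact ZMod.eq_of_natCast_eq hj hj' (by simpa using this)
  have hcol : ∀ v : ZMod m, ∃ x n : ℕ, x ≤ h - 3 + 2 ∧ v = gridPoint a (a + 1) x n := by
    intro v
    obtain ⟨n, hn⟩ := hfk' (v - (-f' v).val * a) (by
      rw [map_sub, map_mul, map_natCast, hfa', ZMod.natCast_zmod_val]; ring)
    have := ZMod.val_lt (-f' v)
    exact ⟨(-f' v).val, n, by omega, by rw [gridPoint, ← hn]; ring⟩
  have hcol_inj : ∀ x x' n n' : ℕ, x ≤ h - 3 + 2 → x' ≤ h - 3 + 2 →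
      gridPoint a (a + 1) x n = gridPoint a (a + 1) x' n' → x = x' := by
    intro x x' n n' hx hx' he
    have := congrArg f' he
    simp only [gridPoint] at this
    rw [map_add, map_add, map_mul, map_mul, map_mul, map_mul, hf', hfa'] at this
    simp only [map_natCast] at this
    exact ZMod.eq_of_natCast_eq (n := h) (by omega) (by omega) (by linear_combination -this)
  have hgrid : IsSwitchGrid a (a + 1) g (h - 3) :=
    { fst_ne := ha
      snd_ne := hb
      even := by
        obtain ⟨p, hp⟩ := hho
        exact ⟨p - 1, by omega⟩
      odd := hgo
      le := by omega
      inj := fun x x' j j' hx hx' hj hj' he =>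
        ⟨hcol_inj x x' j j' hx hx' he, hrow_inj j j' x x' hj hj' he⟩ }
  exact hamiltonCovered_of_switchGraph hm3 (ZMod.ne_neg_of_odd hodd ha)
    (ZMod.ne_neg_of_odd hodd hb) (by simp) ha' hgrid.add_fst_notMem hgrid.add_snd_notMem
    (switchGraph_rows_reachable ha hb hrow hrow_inj) (hgrid.columns_reachable hcol hcol_inj)

/-- The direction `1` together with a direction which does not generate. -/
theorem hamiltonCovered_one_natCast {m A : ℕ} [NeZero m] (hodd : Odd m) (hA : 0 < A)
    (hAm : 2 * A < m) (hu : ¬ IsUnit (A : ZMod m)) :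
    HamiltonCovered ({(A : ZMod m), -(A : ZMod m), 1, -1} : Set (ZMod m)) := by
  obtain ⟨g, hgm, hg1, hgA, f, hf, hfk⟩ := exists_reduction (A : ZMod m)
  rw [ZMod.val_cast_of_lt (by omega)] at hgA
  have hgo : Odd g := hodd.of_dvd_nat hgm
  have hg3 : 3 ≤ g := by
    have := hg1 hu
    obtain ⟨p, hp⟩ := hgo
    omega
  have hgle : g ≤ A := Nat.le_of_dvd hA hgA
  have hgle2 : g ≤ m - 2 * A :=
    Nat.le_of_dvd (by omega) (Nat.dvd_sub hgm (hgA.mul_left 2))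
  have : NeZero g := ⟨by omega⟩
  have : Fact (1 < m) := ⟨by omega⟩
  have hA0 : (A : ZMod m) ≠ 0 := by
    intro h
    have := ZMod.eq_of_natCast_eq (n := m) (i := A) (j := 0) (by omega) (by omega)
      (by simpa using h)
    omega
  have hrow : ∀ v : ZMod m, ∃ j n : ℕ, j < g ∧ v = n * (A : ZMod m) + j * 1 := by
    intro v
    obtain ⟨n, hn⟩ := hfk (v - (f v).val) (by
      rw [map_sub, map_natCast, ZMod.natCast_zmod_val, sub_self])
    exact ⟨(f v).val, n, ZMod.val_lt _, by rw [← hn]; ring⟩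
  have hrow_inj : ∀ j j' n n' : ℕ, j < g → j' < g →
      (n * A + j * 1 : ZMod m) = n' * A + j' * 1 → j = j' := by
    intro j j' n n' hj hj' he
    have := congrArg f he
    simp only [map_add, map_mul, map_natCast, hf] at this
    exact ZMod.eq_of_natCast_eq hj hj' (by simpa using this)
  have hgrid : IsSwitchGrid (A : ZMod m) 1 g 0 :=
    { fst_ne := hA0
      snd_ne := one_ne_zero
      even := Even.zero
      odd := hgo
      le := by omega
      inj := fun x x' j j' hx hx' hj hj' he => by
        obtain rfl := hrow_inj j j' x x' hj hj' he
        refine ⟨?_, rfl⟩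
        have h1 : ((x * A + j : ℕ) : ZMod m) = ((x' * A + j : ℕ) : ZMod m) := by
          simpa [gridPoint] using he
        have hx1 : x * A ≤ 2 * A := Nat.mul_le_mul_right A hx
        have hx2 : x' * A ≤ 2 * A := Nat.mul_le_mul_right A hx'
        have h2 := ZMod.eq_of_natCast_eq (by omega) (by omega) h1
        exact Nat.eq_of_mul_eq_mul_right hA (by omega) }
  refine hamiltonCovered_of_switchGraph (by omega) (ZMod.ne_neg_of_odd hodd hA0)
    (ZMod.ne_neg_of_odd hodd one_ne_zero) ?_ ?_ hgrid.add_fst_notMem hgrid.add_snd_notMem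
    (switchGraph_rows_reachable hA0 one_ne_zero hrow hrow_inj)
    (hgrid.single_column_reachable hgle (by omega))
  · intro h
    have := ZMod.eq_of_natCast_eq (n := m) (i := A) (j := 1) (by omega) (by omega)
      (by simpa using h)
    omega
  · intro h
    have h1 : ((A + 1 : ℕ) : ZMod m) = (0 : ℕ) := by push_cast; rw [h]; ring
    have := ZMod.eq_of_natCast_eq (n := m) (i := A + 1) (j := 0) (by omega) (by omega) h1
    omega

/-- A generating direction together with one which does not generate. -/
theorem hamiltonCovered_unit_nonunit {m : ℕ} [NeZero m] (hodd : Odd m) {a b : ZMod m} (ha : a ≠ 0)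
    (hau : ¬ IsUnit a) (hb : IsUnit b) : HamiltonCovered ({a, -a, b, -b} : Set (ZMod m)) := by
  obtain ⟨b, rfl⟩ := hb
  obtain ⟨c, hc⟩ : ∃ c, c = (b⁻¹ : (ZMod m)ˣ) * a := ⟨_, rfl⟩
  have hbc : (b : ZMod m) * c = a := by rw [hc, Units.mul_inv_cancel_left]
  have hcu : ¬ IsUnit c := by
    intro h
    exact hau (hbc ▸ b.isUnit.mul h)
  have hc0 : c ≠ 0 := by rintro rfl; exact ha (by rw [← hbc, mul_zero])
  have hval := ZMod.val_lt c
  have hpos : 0 < c.val := ZMod.val_pos.2 hc0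
  obtain ⟨p, hp⟩ := hodd
  -- one of `c` and `-c` has a representative less than `m / 2`
  by_cases hlt : 2 * c.val < m
  · have h1 := (hamiltonCovered_one_natCast ⟨p, hp⟩ hpos hlt
      (by rwa [ZMod.natCast_zmod_val])).smul b
    rw [ZMod.natCast_zmod_val] at h1
    simpa [Set.image_insert_eq, hbc] using h1
  · have h2 : ((m - c.val : ℕ) : ZMod m) = -c := by
      rw [Nat.cast_sub hval.le, ZMod.natCast_self, ZMod.natCast_zmod_val, zero_sub]
    have h1 := (hamiltonCovered_one_natCast (A := m - c.val) ⟨p, hp⟩ (by omega) (by omega)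
      (by rwa [h2, IsUnit.neg_iff])).smul b
    rw [h2] at h1
    simp only [Set.image_insert_eq, Set.image_singleton, mul_neg, neg_neg, hbc, mul_one] at h1
    rwa [Set.insert_comm] at h1

/-- If `a` and `a + 1` are units, the circulant cycles suffice. If one of them is a unit, it may be
scaled to `1`. Otherwise the numbers of cosets of `a` and of `a + 1` are distinct, and the direction
with more cosets takes the role of the rows. -/
theorem hamiltonCovered_consecutive {m : ℕ} [NeZero m] (hodd : Odd m) {a : ZMod m} (ha : a ≠ 0)
    (hb : a + 1 ≠ 0) (hab : a ≠ -(a + 1)) :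
    HamiltonCovered ({a, -a, a + 1, -(a + 1)} : Set (ZMod m)) := by
  have hm1 : m ≠ 1 := by rintro rfl; exact ha (Subsingleton.elim _ _)
  have : Fact (1 < m) := ⟨by have := NeZero.pos m; omega⟩
  have hswap : ∀ x y : ZMod m, ({x, -x, y, -y} : Set (ZMod m)) = {y, -y, x, -x} := by
    intro x y
    ext w
    simp only [Set.mem_insert_iff, Set.mem_singleton_iff]
    tauto
  by_cases hau : IsUnit a <;> by_cases hbu : IsUnit (a + 1)
  · have h1 := ZMod.ne_neg_of_odd hodd ha
    have h2 := ZMod.ne_neg_of_odd hodd hb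
    have h3 : -a ≠ a + 1 := fun h => hab (by rw [← h, neg_neg])
    have h4 : a ≠ a + 1 := by simp
    have h5 : -a ≠ -(a + 1) := fun h => h4 (neg_injective h)
    refine (hamiltonCovered_singleton hau).union ((hamiltonCovered_singleton hau.neg).union
      ((hamiltonCovered_singleton hbu).union (hamiltonCovered_singleton hbu.neg) ?_) ?_) ?_
    · simpa using h2
    · rw [Set.disjoint_singleton_left]
      rintro (h | h)
      · exact h3 h
      · exact h5 h
    · rw [Set.disjoint_singleton_left]
      rintro (h | h | h)
      · exact h1 h
      · exact h4 h
      · exact hab h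
  · rw [hswap]
    exact hamiltonCovered_unit_nonunit hodd hb hbu hau
  · exact hamiltonCovered_unit_nonunit hodd ha hau hbu
  · obtain ⟨g, hgm, hg1, -, f, hf, hfk⟩ := exists_reduction a
    obtain ⟨h, hhm, hh1, -, f', hf', hfk'⟩ := exists_reduction (a + 1)
    have hg3 : 3 ≤ g := by
      have := hg1 hau
      obtain ⟨p, hp⟩ := hodd.of_dvd_nat hgm
      omega
    have hh3 : 3 ≤ h := by
      have := hh1 hbu
      obtain ⟨p, hp⟩ := hodd.of_dvd_nat hhm
      omega
    rcases lt_trichotomy h g with hlt | rfl | hlt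
    · exact hamiltonCovered_of_reductions hodd hgm hhm hh3 hlt hab f hf hfk f' hf' hfk'
    · have : Fact (1 < h) := ⟨by omega⟩
      rw [Subsingleton.elim f' f, map_add, hf, map_one, zero_add] at hf'
      exact absurd hf' one_ne_zero
    · -- the roles of the two directions are interchanged by `a ↦ -(a + 1)`
      have e : -(a + 1) + 1 = -a := by ring
      have := hamiltonCovered_of_reductions (a := -(a + 1)) hodd hhm hgm hg3 hlt
        (by rw [e, neg_neg]; exact hab.symm) f' (by rw [map_neg, hf', neg_zero])
        (fun v hv => by
          obtain ⟨n, hn⟩ := hfk' (-v) (by rw [map_neg, hv, neg_zero])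
          exact ⟨n, by linear_combination -hn⟩)
        f (by rw [e, map_neg, hf, neg_zero])
        (fun v hv => by
          obtain ⟨n, hn⟩ := hfk (-v) (by rw [map_neg, hv, neg_zero])
          exact ⟨n, by rw [e]; linear_combination -hn⟩)
      rw [e, neg_neg, neg_neg] at this
      convert this using 1
      ext w
      simp only [Set.mem_insert_iff, Set.mem_singleton_iff]
      tauto

/-! ### Circulants with all differences except `1` and a unit -/

/-- The differences `±a` with `lo ≤ a < hi`. -/
def differenceRange (m lo hi : ℕ) : Set (ZMod m) :=
  {x | ∃ a : ℕ, lo ≤ a ∧ a < hi ∧ (x = a ∨ x = -a)}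

/-- Distinct numbers between `1` and `m / 2` are not congruent up to sign. -/
theorem ZMod.eq_of_natCast_eq_or_neg {m a b : ℕ} (ha : 1 ≤ a) (ha' : 2 * a < m)
    (hb' : 2 * b < m) {x : ZMod m} (h : x = a ∨ x = -a) (h' : x = b ∨ x = -b) : a = b := by
  rcases h with rfl | rfl <;> rcases h' with h' | h'
  · exact ZMod.eq_of_natCast_eq (by omega) (by omega) h'
  · have h1 : ((a + b : ℕ) : ZMod m) = (0 : ℕ) := by push_cast; rw [h']; ring
    have := ZMod.eq_of_natCast_eq (by omega) (by omega) h1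
    omega
  · have h1 : ((a + b : ℕ) : ZMod m) = (0 : ℕ) := by push_cast; rw [← h']; ring
    have := ZMod.eq_of_natCast_eq (by omega) (by omega) h1
    omega
  · exact ZMod.eq_of_natCast_eq (by omega) (by omega) (neg_injective h')

theorem ZMod.exists_natCast_eq_or_neg {m : ℕ} [NeZero m] (hodd : Odd m) {x : ZMod m}
    (hx : x ≠ 0) : ∃ a : ℕ, 1 ≤ a ∧ 2 * a < m ∧ (x = a ∨ x = -a) := by
  have h1 := ZMod.val_lt x
  have h2 : 0 < x.val := ZMod.val_pos.2 hx
  obtain ⟨p, hp⟩ := hodd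
  by_cases h : 2 * x.val < m
  · exact ⟨x.val, h2, h, Or.inl (ZMod.natCast_zmod_val x).symm⟩
  · refine ⟨m - x.val, by omega, by omega, Or.inr ?_⟩
    rw [Nat.cast_sub h1.le, ZMod.natCast_self, ZMod.natCast_zmod_val]
    ring

theorem differenceRange_union {m lo mid hi : ℕ} (h1 : lo ≤ mid) (h2 : mid ≤ hi) :
    differenceRange m lo mid ∪ differenceRange m mid hi = differenceRange m lo hi := by
  ext x
  constructor
  · rintro (⟨a, h3, h4, h5⟩ | ⟨a, h3, h4, h5⟩)
    · exact ⟨a, h3, by omega, h5⟩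
    · exact ⟨a, by omega, h4, h5⟩
  · rintro ⟨a, h3, h4, h5⟩
    rcases lt_or_ge a mid with h6 | h6
    · exact Or.inl ⟨a, h3, h6, h5⟩
    · exact Or.inr ⟨a, h6, h4, h5⟩

theorem differenceRange_disjoint {m lo mid mid' hi : ℕ} (h1 : 1 ≤ lo) (h2 : mid ≤ mid')
    (h3 : 2 * hi ≤ m + 1) (h4 : mid ≤ hi) :
    Disjoint (differenceRange m lo mid) (differenceRange m mid' hi) := by
  rw [Set.disjoint_left]
  rintro x ⟨a, ha, ha', h⟩ ⟨b, hb, hb', h'⟩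
  have := ZMod.eq_of_natCast_eq_or_neg (by omega) (by omega) (by omega) h h'
  omega

theorem HamiltonCovered.differenceRange_append {m lo mid hi : ℕ}
    (hD : HamiltonCovered (differenceRange m lo mid))
    (hE : HamiltonCovered (differenceRange m mid hi)) (h1 : 1 ≤ lo) (h2 : lo ≤ mid)
    (h3 : mid ≤ hi) (h4 : 2 * hi ≤ m + 1) : HamiltonCovered (differenceRange m lo hi) := by
  rw [← differenceRange_union h2 h3]
  exact hD.union hE (differenceRange_disjoint h1 le_rfl h4 h3)

theorem hamiltonCovered_differenceRange_unit {m a : ℕ} (hodd : Odd m) (ha : 1 ≤ a)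
    (ha' : 2 * a < m) (hu : IsUnit (a : ZMod m)) :
    HamiltonCovered (differenceRange m a (a + 1)) := by
  have h0 : (a : ZMod m) ≠ 0 := by
    intro h
    have := ZMod.eq_of_natCast_eq (n := m) (i := a) (j := 0) (by omega) (by omega)
      (by simpa using h)
    omega
  have h1 := (hamiltonCovered_singleton hu).union (hamiltonCovered_singleton hu.neg)
    (by simpa using ZMod.ne_neg_of_odd hodd h0)
  convert h1 using 1
  ext x
  constructor
  · rintro ⟨b, hb, hb', h⟩
    obtain rfl : b = a := by omega
    exact h
  · intro h
    exact ⟨a, le_rfl, by omega, h⟩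

/-- An even number of consecutive differences splits into pairs of consecutive differences. -/
theorem hamiltonCovered_differenceRange_even {m : ℕ} [NeZero m] (hodd : Odd m) (n lo : ℕ)
    (hlo : 1 ≤ lo) (h : 2 * (lo + 2 * n) ≤ m + 1) :
    HamiltonCovered (differenceRange m lo (lo + 2 * n)) := by
  induction n with
  | zero =>
    convert hamiltonCovered_empty using 1
    rw [Set.eq_empty_iff_forall_notMem]
    rintro x ⟨a, h1, h2, -⟩
    omega
  | succ n ih =>
    refine (ih (by omega)).differenceRange_append ?_ hlo (by omega) (by omega) h
    set a := lo + 2 * n with ha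
    have hne : ∀ b : ℕ, 0 < b → b < m → (b : ZMod m) ≠ 0 := by
      intro b hb hb' h
      have := ZMod.eq_of_natCast_eq (n := m) (i := b) (j := 0) hb' (by omega) (by simpa using h)
      omega
    have h1 := hamiltonCovered_consecutive (a := (a : ZMod m)) hodd (hne a (by omega) (by omega))
      (by simpa using hne (a + 1) (by omega) (by omega)) (fun h => by
        refine hne (2 * a + 1) (by omega) (by omega) ?_
        push_cast
        linear_combination h)
    convert h1 using 1
    ext x
    constructor
    · rintro ⟨b, hb, hb', h⟩
      obtain rfl | rfl : b = a ∨ b = a + 1 := by omega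
      · rcases h with h | h <;> simp [h]
      · rcases h with h | h <;> simp [h]
    · rintro (h | h | h | h)
      · exact ⟨a, le_rfl, by omega, Or.inl h⟩
      · exact ⟨a, le_rfl, by omega, Or.inr h⟩
      · exact ⟨a + 1, by omega, by omega, Or.inl (by simpa using h)⟩
      · exact ⟨a + 1, by omega, by omega, Or.inr (by rw [Nat.cast_add_one]; exact h)⟩

/-- For an odd number of differences starting with the unit `2`, the difference `2` is treated
separately. -/
theorem hamiltonCovered_differenceRange_two {m : ℕ} [NeZero m] (hodd : Odd m) (hi : ℕ)
    (h2 : 2 ≤ hi) (h : 2 * hi ≤ m + 1) : HamiltonCovered (differenceRange m 2 hi) := by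
  rcases Nat.even_or_odd' hi with ⟨c, rfl | rfl⟩
  · have := hamiltonCovered_differenceRange_even hodd (c - 1) 2 (by omega) (by omega)
    rwa [show 2 + 2 * (c - 1) = 2 * c by omega] at this
  · have h1 := hamiltonCovered_differenceRange_even hodd (c - 1) 3 (by omega) (by omega)
    rw [show 3 + 2 * (c - 1) = 2 * c + 1 by omega] at h1
    refine (hamiltonCovered_differenceRange_unit hodd (by omega) (by omega)
      ?_).differenceRange_append h1 (by omega) (by omega) (by omega) h
    exact (ZMod.isUnit_iff_coprime 2 m).2 (Nat.coprime_two_left.2 hodd)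

/-- For an odd number of differences ending with the unit `(m - 1) / 2`, this difference is treated
separately. -/
theorem hamiltonCovered_differenceRange_half {m k : ℕ} [NeZero m] (hm : m = 2 * k + 1) (lo : ℕ)
    (h1 : 1 ≤ lo) (h2 : lo ≤ k + 1) : HamiltonCovered (differenceRange m lo (k + 1)) := by
  have hodd : Odd m := ⟨k, hm⟩
  obtain ⟨c, hc | hc⟩ : ∃ c, k + 1 - lo = 2 * c ∨ k + 1 - lo = 2 * c + 1 :=
    Nat.even_or_odd' (k + 1 - lo)
  · have := hamiltonCovered_differenceRange_even hodd c lo h1 (by omega)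
    rwa [show lo + 2 * c = k + 1 by omega] at this
  · have h3 := hamiltonCovered_differenceRange_even hodd c lo h1 (by omega)
    rw [show lo + 2 * c = k by omega] at h3
    refine h3.differenceRange_append
      (hamiltonCovered_differenceRange_unit hodd (by omega) (by omega) ?_) h1 (by omega) (by omega)
      (by omega)
    refine (ZMod.isUnit_iff_coprime k m).2 ?_
    rw [hm]
    simp

/-- The complete symmetric digraph on `ZMod m` minus the circulant Hamiltonian cycles with
differences `1` and `q`. -/
theorem hamiltonCovered_compl {m : ℕ} (hodd : Odd m) (h5 : 5 ≤ m) {q : ZMod m} (hq : IsUnit q)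
    (hq1 : q ≠ 1) : HamiltonCovered {x : ZMod m | x ≠ 0 ∧ x ≠ 1 ∧ x ≠ q} := by
  have : NeZero m := ⟨by omega⟩
  have : Fact (1 < m) := ⟨by omega⟩
  have hq0 : q ≠ 0 := hq.ne_zero
  obtain ⟨k, hk⟩ := hodd
  have hodd : Odd m := ⟨k, hk⟩
  have h1 : (1 : ZMod m) = (1 : ℕ) := by simp
  obtain ⟨Q, hQ1, hQ2, hQ⟩ := ZMod.exists_natCast_eq_or_neg hodd hq0
  by_cases hqn : q = -1
  · convert hamiltonCovered_differenceRange_two hodd (k + 1) (by omega) (by omega) using 1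
    ext x
    constructor
    · rintro ⟨hx0, hx1, hxq⟩
      obtain ⟨a, ha, ha', h⟩ := ZMod.exists_natCast_eq_or_neg hodd hx0
      refine ⟨a, ?_, by omega, h⟩
      by_contra hlt
      obtain rfl : a = 1 := by omega
      rcases h with rfl | rfl
      · exact hx1 (by simp)
      · exact hxq (by simp [hqn])
    · rintro ⟨a, ha, ha', h⟩
      refine ⟨?_, ?_, ?_⟩
      · rintro rfl
        have := ZMod.eq_of_natCast_eq_or_neg (by omega) (by omega) (by omega : 2 * 0 < m) h
          (by simp)
        omega
      · rintro rfl
        have := ZMod.eq_of_natCast_eq_or_neg (by omega) (by omega) (by omega : 2 * 1 < m) h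
          (by simp)
        omega
      · rintro rfl
        have := ZMod.eq_of_natCast_eq_or_neg (by omega) (by omega) (by omega : 2 * 1 < m) h
          (by simp [hqn])
        omega
  · have hQ2' : 2 ≤ Q := by
      by_contra hlt
      obtain rfl : Q = 1 := by omega
      rcases hQ with h | h
      · exact hq1 (by simpa using h)
      · exact hqn (by simpa using h)
    have hne : ∀ lo hi : ℕ, 2 ≤ lo → 2 * hi ≤ m + 1 → (-1 : ZMod m) ∉ differenceRange m lo hi := by
      rintro lo hi hlo hhi ⟨a, ha, ha', h⟩
      have := ZMod.eq_of_natCast_eq_or_neg (by omega) (by omega) (by omega : 2 * 1 < m) h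
        (by simp)
      omega
    have hneg : ∀ x : ZMod m, ∀ b : ℕ, (x = b ∨ x = -b) → (-x = b ∨ -x = -b) := by
      rintro x b (h | h)
      · right; rw [h]
      · left; rw [h, neg_neg]
    have hdisj := differenceRange_disjoint (m := m) (lo := 2) (mid := Q) (mid' := Q + 1)
      (hi := k + 1) (by omega) (by omega) (by omega) (by omega)
    have hQnot : (-q) ∉ differenceRange m 2 Q ∪ differenceRange m (Q + 1) (k + 1) := by
      rintro (⟨a, ha, ha', h⟩ | ⟨a, ha, ha', h⟩)
      · have := ZMod.eq_of_natCast_eq_or_neg (by omega) (by omega) (by omega) h (hneg _ _ hQ)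
        omega
      · have := ZMod.eq_of_natCast_eq_or_neg (by omega) (by omega) (by omega) h (hneg _ _ hQ)
        omega
    have hcov := (hamiltonCovered_singleton (isUnit_one (M := ZMod m)).neg).union
      ((hamiltonCovered_singleton hq.neg).union
        ((hamiltonCovered_differenceRange_two hodd Q hQ2' (by omega)).union
          (hamiltonCovered_differenceRange_half hk (Q + 1) (by omega) (by omega)) hdisj)
        (Set.disjoint_singleton_left.2 hQnot))
      (Set.disjoint_singleton_left.2 (by
        rintro (h | h | h)
        · exact hq1 (neg_injective h).symm
        · exact hne _ _ le_rfl (by omega) h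
        · exact hne _ _ (by omega) (by omega) h))
    convert hcov using 1
    ext x
    constructor
    · rintro ⟨hx0, hx1, hxq⟩
      obtain ⟨a, ha, ha', h⟩ := ZMod.exists_natCast_eq_or_neg hodd hx0
      by_cases ha1 : a = 1
      · left
        subst ha1
        rcases h with h | h
        · exact absurd (by simpa using h) hx1
        · simpa using h
      · rcases lt_trichotomy a Q with hlt | rfl | hlt
        · exact Or.inr (Or.inr (Or.inl ⟨a, by omega, hlt, h⟩))
        · right; left
          rcases h with h | h <;> rcases hQ with h' | h'
          · exact absurd (h.trans h'.symm) hxq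
          · exact h.trans (by rw [h', neg_neg])
          · exact h.trans (by rw [h'])
          · exact absurd (h.trans h'.symm) hxq
        · exact Or.inr (Or.inr (Or.inr ⟨a, hlt, by omega, h⟩))
    · have hrange : ∀ a : ℕ, 2 ≤ a → 2 * a < m → a ≠ Q → (x = a ∨ x = -a) →
          x ≠ 0 ∧ x ≠ 1 ∧ x ≠ q := by
        intro a ha ha' haQ h
        refine ⟨?_, ?_, ?_⟩
        · rintro rfl
          have := ZMod.eq_of_natCast_eq_or_neg (by omega) (by omega) (by omega : 2 * 0 < m) h
            (by simp)
          omega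
        · rintro rfl
          have := ZMod.eq_of_natCast_eq_or_neg (by omega) (by omega) (by omega : 2 * 1 < m) h
            (by simp)
          omega
        · rintro rfl
          exact haQ (ZMod.eq_of_natCast_eq_or_neg (by omega) (by omega) (by omega) h hQ)
      rintro (h | h | ⟨a, ha, ha', h⟩ | ⟨a, ha, ha', h⟩)
      · rw [Set.mem_singleton_iff] at h
        subst h
        refine ⟨by simp, fun h => ?_, fun h => hqn h.symm⟩
        exact ZMod.ne_neg_of_odd hodd one_ne_zero h.symm
      · rw [Set.mem_singleton_iff] at h
        subst h
        refine ⟨neg_ne_zero.2 hq0, fun h => hqn ?_, (ZMod.ne_neg_of_odd hodd hq0).symm⟩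
        rw [← h, neg_neg]
      · exact hrange a ha (by omega) (by omega) h
      · exact hrange a (by omega) (by omega) (by omega) h

/-! ### Cycles and paths from the given decompositions -/

theorem Digraph.Subdigraph.IsDirectedCycle.exists_perm {m : ℕ} [NeZero m] {D : Digraph (ZMod m)}
    {H : D.Subdigraph} (h : H.IsDirectedCycle m) :
    ∃ c : Equiv.Perm (ZMod m), ∀ u v, H.Adj u v ↔ cycleNext c u = v := by
  obtain ⟨-, c, hc, -, hadj⟩ := h
  let c' : Equiv.Perm (ZMod m) := Equiv.ofBijective c (Finite.injective_iff_bijective.1 hc)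
  refine ⟨c', fun u v => ?_⟩
  rw [hadj]
  constructor
  · rintro ⟨i, rfl, rfl⟩
    exact cycleNext_apply c' i
  · rintro rfl
    obtain ⟨i, rfl⟩ := c'.surjective u
    exact ⟨i, rfl, cycleNext_apply c' i⟩

/-- The vertices of a directed path as a sequence indexed by natural numbers, of which only the
terms up to the length matter. -/
theorem Digraph.Subdigraph.IsDirectedPath.exists_seq {V : Type*} {D : Digraph V}
    {H : D.Subdigraph} {s t : V} {r : ℕ} (h : H.IsDirectedPath s t r) :
    ∃ P : ℕ → V, P 0 = s ∧ P r = t ∧ (∀ i ≤ r, ∀ j ≤ r, P i = P j → i = j) ∧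
      (∀ i ≤ r, P i ∈ H.verts) ∧ ∀ u v, H.Adj u v → ∃ i < r, u = P i ∧ v = P (i + 1) := by
  obtain ⟨p, hp, h0, hl, hv, hadj⟩ := h
  have hcast : ∀ (i : ℕ) (hi : i < r + 1), Fin.ofNat (r + 1) i = ⟨i, hi⟩ := fun i hi =>
    Fin.ext (Nat.mod_eq_of_lt hi)
  refine ⟨fun i => p (Fin.ofNat (r + 1) i), ?_, ?_, ?_, ?_, ?_⟩
  · rw [← h0]; rfl
  · rw [← hl]
    exact congrArg p (hcast r (by omega))
  · intro i hi j hj hij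
    have := hp hij
    rw [hcast i (by omega), hcast j (by omega)] at this
    exact congrArg Fin.val this
  · intro i hi
    rw [hv]
    exact ⟨_, rfl⟩
  · intro u v huv
    obtain ⟨i, rfl, rfl⟩ := (hadj u v).1 huv
    refine ⟨i, i.2, congrArg p ?_, congrArg p ?_⟩
    · rw [hcast i (by omega)]; rfl
    · rw [hcast (i + 1) (by omega)]; rfl

/-- The given decompositions, put together: apart from the arcs with difference `e`, the two deleted
arcs and the arcs of the two paths, all arcs are covered by at most `m - 3` directed Hamiltonian
cycles. These are indexed by their out-neighbours of `t 0`. -/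
theorem exists_cycles_of_decompositions {m : ℕ} [NeZero m] (e : ZMod m) (he : e ≠ 0)
    (s t : Fin 2 → ZMod m) (r : Fin 2 → ℕ) (S : Set (ZMod m)) (hS : S ⊆ {x | x ≠ 0}) (heS : e ∉ S)
    (hst : ∀ i, s i - t i ∈ S)
    (h1 : (Digraph.directedCirculant m
      ({x | x ≠ 0} \ (S ∪ {e}))).AdmitsDirectedCycleDecomposition m)
    (h2 : ((Digraph.directedCirculant m S).deleteArcs
      {(t 0, s 0), (t 1, s 1)}).AdmitsDirectedCyclesTwoPathsDecomposition m s t r) :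
    ∃ (T : Set (ZMod m)) (c : ZMod m → Equiv.Perm (ZMod m)) (P : Fin 2 → ℕ → ZMod m),
      T ⊆ {t 0, t 0 + e, s 0}ᶜ ∧ ({t 0, t 0 + e, s 0} : Set (ZMod m)).ncard = 3 ∧
      (∀ i, P i 0 = s i ∧ P i (r i) = t i) ∧
      (∀ i, ∀ j ≤ r i, ∀ j' ≤ r i, P i j = P i j' → j = j') ∧
      (∀ j ≤ r 0, ∀ j' ≤ r 1, P 0 j ≠ P 1 j') ∧
      ∀ u v, u ≠ v → v - u ≠ e → (∃ i, u = t i ∧ v = s i) ∨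
        (∃ i, ∃ j < r i, u = P i j ∧ v = P i (j + 1)) ∨ ∃ w ∈ T, cycleNext (c w) u = v := by
  obtain ⟨𝒟, ⟨-, hpart⟩, hcyc⟩ := h1
  obtain ⟨𝒟', Q, ⟨-, hpart'⟩, hQ, hdisj, hcyc'⟩ := h2
  choose P hP0 hPr hPinj hPv hPadj using fun i => (hQ i).2.exists_seq
  let 𝒞 : Set (ZMod m → ZMod m → Prop) :=
    {A | (∃ H ∈ 𝒟, A = H.Adj) ∨ ∃ H ∈ 𝒟', (∀ i, H ≠ Q i) ∧ A = H.Adj}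
  have hst0 := hst 0
  have hperm : ∀ A ∈ 𝒞, ∃ c : Equiv.Perm (ZMod m), ∀ u v, A u v ↔ cycleNext c u = v := by
    rintro _ (⟨H, hH, rfl⟩ | ⟨H, hH, hHQ, rfl⟩)
    · exact (hcyc H hH).exists_perm
    · exact (hcyc' H hH hHQ).exists_perm
  have hdiff : ∀ H ∈ 𝒟, ∀ u v, H.Adj u v → v - u ≠ 0 ∧ v - u ∉ S ∧ v - u ≠ e := by
    intro H hH u v huv
    obtain ⟨d, ⟨hd0, hdS⟩, rfl⟩ := H.adj_sub u v huv
    rw [add_sub_cancel_left]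
    exact ⟨hd0, fun h => hdS (Or.inl h), fun h => hdS (Or.inr h)⟩
  have hdiff' : ∀ H ∈ 𝒟', ∀ u v, H.Adj u v → v - u ∈ S ∧ (u, v) ≠ (t 0, s 0) := by
    intro H hH u v huv
    obtain ⟨⟨d, hdS, rfl⟩, hne⟩ := H.adj_sub u v huv
    rw [add_sub_cancel_left]
    exact ⟨hdS, fun h => hne (Or.inl h)⟩
  have huniq : ∀ A ∈ 𝒞, ∀ B ∈ 𝒞, ∀ u v, A u v → B u v → A = B := by
    rintro _ (⟨H, hH, rfl⟩ | ⟨H, hH, hHQ, rfl⟩) _ (⟨H', hH', rfl⟩ | ⟨H', hH', hHQ', rfl⟩) u v h h'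
    · rw [(hpart u v (H.adj_sub u v h)).unique ⟨hH, h⟩ ⟨hH', h'⟩]
    · exact absurd (hdiff' H' hH' u v h').1 (hdiff H hH u v h).2.1
    · exact absurd (hdiff' H hH u v h).1 (hdiff H' hH' u v h').2.1
    · rw [(hpart' u v (H.adj_sub u v h)).unique ⟨hH, h⟩ ⟨hH', h'⟩]
  have hc : ∀ w, ∃ c : Equiv.Perm (ZMod m), ∀ A ∈ 𝒞, A (t 0) w →
      ∀ u v, A u v ↔ cycleNext c u = v := by
    intro w
    by_cases h : ∃ A ∈ 𝒞, A (t 0) w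
    · obtain ⟨A, hA, hw⟩ := h
      obtain ⟨c, hc⟩ := hperm A hA
      refine ⟨c, fun B hB hBw => ?_⟩
      rw [huniq B hB A hA _ _ hBw hw]
      exact hc
    · exact ⟨1, fun A hA hw => absurd ⟨A, hA, hw⟩ h⟩
  choose c hc using hc
  refine ⟨{w | ∃ A ∈ 𝒞, A (t 0) w}, c, P, ?_, ?_, fun i => ⟨hP0 i, hPr i⟩, hPinj, ?_, ?_⟩
  · rintro w ⟨_, ⟨H, hH, rfl⟩ | ⟨H, hH, hHQ, rfl⟩, hw⟩ (rfl | rfl | rfl)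
    · exact (hdiff H hH _ _ hw).1 (sub_self _)
    · exact (hdiff H hH _ _ hw).2.2 (add_sub_cancel_left _ _)
    · exact (hdiff H hH _ _ hw).2.1 hst0
    · exact hS (hdiff' H hH _ _ hw).1 (sub_self _)
    · exact heS (by simpa using (hdiff' H hH _ _ hw).1)
    · exact (hdiff' H hH _ _ hw).2 rfl
  · rw [Set.ncard_eq_three]
    refine ⟨_, _, _, ?_, ?_, ?_, rfl⟩
    · simpa using he
    · intro h
      exact hS hst0 (by rw [h, sub_self])
    · intro h
      refine heS ?_
      rw [← h, add_sub_cancel_left] at hst0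
      exact hst0
  · intro j hj j' hj' h
    exact Set.disjoint_left.1 hdisj (hPv 0 j hj) (h ▸ hPv 1 j' hj')
  · intro u v huv hne
    have hcover : ∀ A ∈ 𝒞, A u v → ∃ w ∈ {w | ∃ A ∈ 𝒞, A (t 0) w}, cycleNext (c w) u = v := by
      intro A hA h
      obtain ⟨c', hc'⟩ := hperm A hA
      have hw : A (t 0) (cycleNext c' (t 0)) := (hc' _ _).2 rfl
      exact ⟨_, ⟨A, hA, hw⟩, (hc _ A hA hw u v).1 h⟩
    by_cases hS' : v - u ∈ S
    · by_cases hdel : (u, v) ∈ ({(t 0, s 0), (t 1, s 1)} : Set (ZMod m × ZMod m))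
      · left
        rcases hdel with h | h
        · exact ⟨0, (Prod.ext_iff.1 h).1, (Prod.ext_iff.1 h).2⟩
        · exact ⟨1, (Prod.ext_iff.1 h).1, (Prod.ext_iff.1 h).2⟩
      · right
        obtain ⟨H, ⟨hH, h⟩, -⟩ := hpart' u v ⟨⟨v - u, hS', by ring⟩, hdel⟩
        by_cases hHQ : ∃ i, H = Q i
        · obtain ⟨i, rfl⟩ := hHQ
          exact Or.inl ⟨i, hPadj i u v h⟩
        · exact Or.inr (hcover _ (Or.inr ⟨H, hH, fun i hi => hHQ ⟨i, hi⟩, rfl⟩) h)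
    · right; right
      obtain ⟨H, ⟨hH, h⟩, -⟩ := hpart u v ⟨v - u, ⟨fun h => huv (sub_eq_zero.1 h).symm,
        fun h => h.elim hS' hne⟩, by ring⟩
      exact hcover _ (Or.inl ⟨H, hH, rfl⟩) h

/-! ### The starter -/

theorem pairNext_trans {m : ℕ} {V V' : Type*} (c : ZMod m ⊕ ZMod m ≃ V) (e : V ≃ V') (u : V) :
    pairNext (c.trans e) (e u) = e (pairNext c u) := by
  simp [pairNext]

/-- Two sequences of length `m` which together run through all vertices describe a spanning pair of
disjoint directed `m`-cycles. -/
theorem exists_pair_of_seq {m : ℕ} [NeZero m] (a b : ℕ → ZMod m ⊕ ZMod m)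
    (h : ∀ w, ∃ n < m, a n = w ∨ b n = w) :
    ∃ c : Equiv.Perm (ZMod m ⊕ ZMod m),
      (∀ n, n + 1 < m → pairNext c (a n) = a (n + 1)) ∧ pairNext c (a (m - 1)) = a 0 ∧
      (∀ n, n + 1 < m → pairNext c (b n) = b (n + 1)) ∧ pairNext c (b (m - 1)) = b 0 := by
  let f : ZMod m ⊕ ZMod m → ZMod m ⊕ ZMod m := Sum.elim (fun i => a i.val) (fun i => b i.val)
  have hf : Function.Surjective f := by
    intro w
    obtain ⟨n, hn, rfl | rfl⟩ := h w
    · exact ⟨Sum.inl n, by simp [f, ZMod.val_cast_of_lt hn]⟩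
    · exact ⟨Sum.inr n, by simp [f, ZMod.val_cast_of_lt hn]⟩
  let c : Equiv.Perm (ZMod m ⊕ ZMod m) :=
    Equiv.ofBijective f (Finite.surjective_iff_bijective.1 hf)
  have hl : ∀ n, n < m → c (Sum.inl (n : ZMod m)) = a n := fun n hn => by
    change a (n : ZMod m).val = a n
    rw [ZMod.val_cast_of_lt hn]
  have hr : ∀ n, n < m → c (Sum.inr (n : ZMod m)) = b n := fun n hn => by
    change b (n : ZMod m).val = b n
    rw [ZMod.val_cast_of_lt hn]
  have hpos : 0 < m := NeZero.pos m
  have hlast : ((m - 1 : ℕ) : ZMod m) + 1 = (0 : ℕ) := by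
    rw [← Nat.cast_add_one, Nat.sub_add_cancel hpos, ZMod.natCast_self, Nat.cast_zero]
  refine ⟨c, fun n hn => ?_, ?_, fun n hn => ?_, ?_⟩
  · rw [← hl n (by omega), ← hl (n + 1) hn, pairNext_inl, Nat.cast_add_one]
  · rw [← hl (m - 1) (by omega), ← hl 0 hpos, pairNext_inl, hlast]
  · rw [← hr n (by omega), ← hr (n + 1) hn, pairNext_inr, Nat.cast_add_one]
  · rw [← hr (m - 1) (by omega), ← hr 0 hpos, pairNext_inr, hlast]

theorem ZMod.natCast_eq_of_eq_or {m a b : ℕ} (h : a = b ∨ a + m = b ∨ a = b + m) :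
    (a : ZMod m) = b := by
  rcases h with rfl | rfl | rfl <;> simp

namespace Starter

/-! The vertices `x_i` are `Sum.inl i`, the vertices `y_j` are `Sum.inr j`. With `m = 2 * k + 1` and
`p = (k - 1) / 2`, the first cycle of the starter visits `x`- and `y`-vertices alternately,
`x (xA 0), y (yA 0), …, y (yA (k - 1)), x (xA k)`, and the second one is
`y (yB 0), x (xB 0), …, x (xB (k - 1)), y (yB k)`. Both consist of two zigzags. -/

/-- Indices of the `x`-vertices of the first starter cycle. -/
def xA (k p l : ℕ) : ℕ := if l ≤ p then l else if l < k then 2 * k - 1 - l else 2 * k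

/-- Indices of the `y`-vertices of the first starter cycle. -/
def yA (k p l : ℕ) : ℕ := if l < p then 2 * k + 1 - l else l + 2

/-- Indices of the `x`-vertices of the second starter cycle. -/
def xB (k p l : ℕ) : ℕ := if l + p + 2 ≤ k then k - 1 - l else k + l

/-- Indices of the `y`-vertices of the second starter cycle. -/
def yB (k p l : ℕ) : ℕ := if l + p + 1 ≤ k then k + 2 + l else k + 1 - l

/-- The starter: a spanning pair of cycles in which each difference of arcs from the `x`- to the
`y`-vertices occurs except `k + 3`, each difference of arcs from the `y`- to the `x`-vertices except
`-1`, and besides one arc between `x`-vertices with difference `1` and one arc between `y`-vertices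
with difference `k + 1`. -/
theorem exists_starter {m k : ℕ} (hm : m = 2 * k + 1) (hk : 3 ≤ k) :
    ∃ c : Equiv.Perm (ZMod m ⊕ ZMod m),
      (∃ a : ZMod m, pairNext c (Sum.inl a) = Sum.inl (a + 1)) ∧
      (∃ a : ZMod m, pairNext c (Sum.inr a) = Sum.inr (a + (k + 1))) ∧
      (∀ δ : ZMod m, δ ≠ k + 3 → ∃ a, pairNext c (Sum.inl a) = Sum.inr (a + δ)) ∧
      ∀ δ : ZMod m, δ ≠ -1 → ∃ a, pairNext c (Sum.inr a) = Sum.inl (a + δ) := by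
  have : NeZero m := ⟨by omega⟩
  obtain ⟨p, hp⟩ : ∃ p, k = 2 * p + 1 ∨ k = 2 * p + 2 := by
    rcases Nat.even_or_odd' k with ⟨c, h | h⟩
    · exact ⟨c - 1, by omega⟩
    · exact ⟨c, by omega⟩
  let x : ℕ → ZMod m ⊕ ZMod m := fun i => Sum.inl (i : ZMod m)
  let y : ℕ → ZMod m ⊕ ZMod m := fun i => Sum.inr (i : ZMod m)
  let a : ℕ → ZMod m ⊕ ZMod m := fun n =>
    if n % 2 = 0 then x (xA k p (n / 2)) else y (yA k p (n / 2))
  let b : ℕ → ZMod m ⊕ ZMod m := fun n =>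
    if n % 2 = 0 then y (yB k p (n / 2)) else x (xB k p (n / 2))
  have ha0 : ∀ l, a (2 * l) = x (xA k p l) := fun l => by
    simp only [a, Nat.mul_mod_right, if_true]; congr 2; omega
  have ha1 : ∀ l, a (2 * l + 1) = y (yA k p l) := fun l => by
    simp only [a]; rw [if_neg (by omega)]; congr 2; omega
  have hb0 : ∀ l, b (2 * l) = y (yB k p l) := fun l => by
    simp only [b, Nat.mul_mod_right, if_true]; congr 2; omega
  have hb1 : ∀ l, b (2 * l + 1) = x (xB k p l) := fun l => by
    simp only [b]; rw [if_neg (by omega)]; congr 2; omega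
  have hxeq : ∀ i j : ℕ, (i = j ∨ i + m = j ∨ i = j + m) → x i = x j := fun i j h =>
    congrArg Sum.inl (ZMod.natCast_eq_of_eq_or h)
  have hyeq : ∀ i j : ℕ, (i = j ∨ i + m = j ∨ i = j + m) → y i = y j := fun i j h =>
    congrArg Sum.inr (ZMod.natCast_eq_of_eq_or h)
  have hsurj : ∀ w, ∃ n < m, a n = w ∨ b n = w := by
    rintro (v | v)
    · have hv := ZMod.val_lt v
      have hw : (Sum.inl v : ZMod m ⊕ ZMod m) = x v.val := by simp [x]
      rw [hw]
      generalize v.val = v at hv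
      rcases (by omega : v ≤ p ∨ (p < v ∧ v < k) ∨ (k ≤ v ∧ v + p + 2 ≤ 2 * k) ∨
        (2 * k < v + p + 2 ∧ v < 2 * k) ∨ v = 2 * k) with h | h | h | h | h
      · refine ⟨2 * v, by omega, Or.inl ?_⟩
        rw [ha0]; apply hxeq; unfold xA; rw [if_pos h]; omega
      · refine ⟨2 * (k - 1 - v) + 1, by omega, Or.inr ?_⟩
        rw [hb1]; apply hxeq; unfold xB; split_ifs <;> omega
      · refine ⟨2 * (2 * k - 1 - v), by omega, Or.inl ?_⟩
        rw [ha0]; apply hxeq; unfold xA; split_ifs <;> omega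
      · refine ⟨2 * (v - k) + 1, by omega, Or.inr ?_⟩
        rw [hb1]; apply hxeq; unfold xB; split_ifs <;> omega
      · refine ⟨2 * k, by omega, Or.inl ?_⟩
        rw [ha0]; apply hxeq; unfold xA; split_ifs <;> omega
    · have hv := ZMod.val_lt v
      have hw : (Sum.inr v : ZMod m ⊕ ZMod m) = y v.val := by simp [y]
      rw [hw]
      generalize v.val = v at hv
      rcases (by omega : v = 0 ∨ (1 ≤ v ∧ v ≤ p + 1) ∨ (p + 2 ≤ v ∧ v ≤ k + 1) ∨
        (k + 2 ≤ v ∧ v + p ≤ 2 * k + 1) ∨ (2 * k + 1 < v + p)) with h | h | h | h | h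
      · refine ⟨2 * 0 + 1, by omega, Or.inl ?_⟩
        rw [ha1]; apply hyeq; unfold yA; split_ifs <;> omega
      · refine ⟨2 * (k + 1 - v), by omega, Or.inr ?_⟩
        rw [hb0]; apply hyeq; unfold yB; split_ifs <;> omega
      · refine ⟨2 * (v - 2) + 1, by omega, Or.inl ?_⟩
        rw [ha1]; apply hyeq; unfold yA; split_ifs <;> omega
      · refine ⟨2 * (v - (k + 2)), by omega, Or.inr ?_⟩
        rw [hb0]; apply hyeq; unfold yB; split_ifs <;> omega
      · refine ⟨2 * (2 * k + 1 - v) + 1, by omega, Or.inl ?_⟩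
        rw [ha1]; apply hyeq; unfold yA; split_ifs <;> omega
  obtain ⟨c, h1, h2, h3, h4⟩ := exists_pair_of_seq a b hsurj
  have hAxy : ∀ l, l < k → pairNext c (x (xA k p l)) = y (yA k p l) := fun l hl => by
    rw [← ha0, ← ha1]; exact h1 _ (by omega)
  have hAyx : ∀ l, l < k → pairNext c (y (yA k p l)) = x (xA k p (l + 1)) := fun l hl => by
    rw [← ha1, ← ha0]; exact h1 _ (by omega)
  have hByx : ∀ l, l < k → pairNext c (y (yB k p l)) = x (xB k p l) := fun l hl => by
    rw [← hb0, ← hb1]; exact h3 _ (by omega)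
  have hBxy : ∀ l, l < k → pairNext c (x (xB k p l)) = y (yB k p (l + 1)) := fun l hl => by
    rw [← hb1, ← hb0]; exact h3 _ (by omega)
  have hxy : ∀ i j d : ℕ, pairNext c (x i) = y j → (j = i + d ∨ j + m = i + d ∨ j = i + d + m) →
      ∃ a : ZMod m, pairNext c (Sum.inl a) = Sum.inr (a + (d : ZMod m)) := by
    intro i j d h hd
    refine ⟨i, h.trans ?_⟩
    rw [← Nat.cast_add]
    exact hyeq _ _ hd
  have hyx : ∀ i j d : ℕ, pairNext c (y i) = x j → (j = i + d ∨ j + m = i + d ∨ j = i + d + m) →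
      ∃ a : ZMod m, pairNext c (Sum.inr a) = Sum.inl (a + (d : ZMod m)) := by
    intro i j d h hd
    refine ⟨i, h.trans ?_⟩
    rw [← Nat.cast_add]
    exact hxeq _ _ hd
  refine ⟨c, ⟨(2 * k : ℕ), ?_⟩, ⟨1, ?_⟩, fun δ hδ => ?_, fun δ hδ => ?_⟩
  · have h5 : a (m - 1) = x (2 * k) := by
      rw [show m - 1 = 2 * k by omega, ha0]
      apply hxeq; unfold xA; split_ifs <;> omega
    rw [h5, show (0 : ℕ) = 2 * 0 from rfl, ha0] at h2
    refine h2.trans ?_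
    rw [← Nat.cast_add_one]
    apply hxeq; unfold xA; split_ifs <;> omega
  · have h5 : b (m - 1) = y 1 := by
      rw [show m - 1 = 2 * k by omega, hb0]
      apply hyeq; unfold yB; split_ifs <;> omega
    rw [h5, show (0 : ℕ) = 2 * 0 from rfl, hb0] at h4
    have h6 : y 1 = Sum.inr 1 := by simp [y]
    rw [h6] at h4
    refine h4.trans ?_
    have h7 : (1 : ZMod m) + (k + 1) = ((k + 2 : ℕ) : ZMod m) := by push_cast; ring
    rw [h7]
    apply hyeq; unfold yB; split_ifs <;> omega
  · have hd := ZMod.val_lt δ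
    have hne : δ.val ≠ k + 3 := by
      intro h
      apply hδ
      rw [← ZMod.natCast_zmod_val δ, h]
      push_cast; rfl
    rw [← ZMod.natCast_zmod_val δ]
    generalize δ.val = d at hd hne
    rcases (by omega : d = 0 ∨ d = 1 ∨ d = 2 ∨ (d % 2 = 0 ∧ 4 ≤ d ∧ d + 2 * p ≤ 2 * k) ∨
      (d % 2 = 0 ∧ 2 * p + 6 ≤ d) ∨ (d % 2 = 1 ∧ 3 ≤ d ∧ d ≤ 2 * p + 3) ∨
      (d % 2 = 1 ∧ 2 * k + 3 ≤ d + 2 * p)) with h | h | h | h | h | h | h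
    · -- `yA k p 0 = m` represents `0`, because `0 < p`
      refine hxy _ _ _ (hAxy 0 (by omega)) ?_
      unfold xA yA; split_ifs <;> omega
    · refine hxy _ _ _ (hAxy (k - 1) (by omega)) ?_
      unfold xA yA; split_ifs <;> omega
    · refine hxy _ _ _ (hAxy p (by omega)) ?_
      unfold xA yA; split_ifs <;> omega
    · refine hxy _ _ _ (hBxy ((d - 4) / 2) (by omega)) ?_
      unfold xB yB; split_ifs <;> omega
    · refine hxy _ _ _ (hAxy ((d - 4) / 2) (by omega)) ?_
      unfold xA yA; split_ifs <;> omega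
    · refine hxy _ _ _ (hBxy ((2 * k + 1 - d) / 2) (by omega)) ?_
      unfold xB yB; split_ifs <;> omega
    · refine hxy _ _ _ (hAxy ((2 * k + 1 - d) / 2) (by omega)) ?_
      unfold xA yA; split_ifs <;> omega
  · have hd := ZMod.val_lt δ
    have hne : δ.val ≠ 2 * k := by
      intro h
      apply hδ
      rw [← ZMod.natCast_zmod_val δ, h, eq_neg_iff_add_eq_zero, ← Nat.cast_add_one, ← hm,
        ZMod.natCast_self]
    rw [← ZMod.natCast_zmod_val δ]
    generalize δ.val = d at hd hne
    rcases (by omega : d = k - 1 ∨ d = 2 * k - 1 ∨ (d % 2 = 0 ∧ d + 2 * p + 4 ≤ 2 * k) ∨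
      (d % 2 = 0 ∧ 2 * p + 2 ≤ d) ∨ (d % 2 = 1 ∧ d < 2 * p) ∨
      (d % 2 = 1 ∧ 2 * k ≤ d + 2 * p + 1 ∧ d + 3 ≤ 2 * k)) with h | h | h | h | h | h
    · refine hyx _ _ _ (hAyx (k - 1) (by omega)) ?_
      unfold xA yA; split_ifs <;> omega
    · refine hyx _ _ _ (hByx (k - p - 1) (by omega)) ?_
      unfold xB yB; split_ifs <;> omega
    · refine hyx _ _ _ (hAyx ((2 * k - 4 - d) / 2) (by omega)) ?_
      unfold xA yA; split_ifs <;> omega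
    · refine hyx _ _ _ (hByx ((2 * k - 2 - d) / 2) (by omega)) ?_
      unfold xB yB; split_ifs <;> omega
    · refine hyx _ _ _ (hAyx ((d - 1) / 2) (by omega)) ?_
      unfold xA yA; split_ifs <;> omega
    · refine hyx _ _ _ (hByx ((d + 1) / 2) (by omega)) ?_
      unfold xB yB; split_ifs <;> omega

end Starter

/-! ### The two special pairs of cycles -/

/-- The `2 * m`-cycle `x_0, y_0, x_1, y_1, …`, in which the out-neighbours of `x_0`, `x_{-1}`,
`y_{k+1}` and `y_k` are redirected to `x_{k+2}`, `x_{k+1}`, `y_{-1}` and `y_0`, falls apart into two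
cycles of length `m`. -/
theorem exists_redirected_pair {m k : ℕ} (hm : m = 2 * k + 1) (hk : 3 ≤ k) :
    ∃ c : Equiv.Perm (ZMod m ⊕ ZMod m),
      (∀ u : ZMod m, u ≠ 0 → u ≠ -1 → pairNext c (Sum.inl u) = Sum.inr u) ∧
      (∀ u : ZMod m, u ≠ k → u ≠ k + 1 → pairNext c (Sum.inr u) = Sum.inl (u + 1)) ∧
      pairNext c (Sum.inl 0) = Sum.inl (k + 2 : ZMod m) ∧
      pairNext c (Sum.inl (-1)) = Sum.inl (k + 1 : ZMod m) ∧
      pairNext c (Sum.inr (k + 1 : ZMod m)) = Sum.inr (-1) ∧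
      pairNext c (Sum.inr (k : ZMod m)) = Sum.inr 0 := by
  have : NeZero m := ⟨by omega⟩
  let x : ℕ → ZMod m ⊕ ZMod m := fun i => Sum.inl (i : ZMod m)
  let y : ℕ → ZMod m ⊕ ZMod m := fun i => Sum.inr (i : ZMod m)
  let a : ℕ → ZMod m ⊕ ZMod m := fun n =>
    if n = 0 then x 0 else if n = 2 * k - 2 then x (k + 1) else if n = 2 * k - 1 then y (k + 1)
    else if n = 2 * k then y (2 * k) else
      if n % 2 = 1 then x (k + 2 + n / 2) else y (k + 1 + n / 2)
  let b : ℕ → ZMod m ⊕ ZMod m := fun n => if n % 2 = 1 then x (n / 2 + 1) else y (n / 2)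
  have ha0 : a 0 = x 0 := rfl
  have ha1 : a (2 * k - 2) = x (k + 1) := by
    simp only [a]; rw [if_neg (by omega), if_pos trivial]
  have ha2 : a (2 * k - 1) = y (k + 1) := by
    simp only [a]; rw [if_neg (by omega), if_neg (by omega), if_pos trivial]
  have ha3 : a (2 * k) = y (2 * k) := by
    simp only [a]
    rw [if_neg (by omega), if_neg (by omega), if_neg (by omega), if_pos trivial]
  have hax : ∀ u, k + 2 ≤ u → u ≤ 2 * k → a (2 * (u - (k + 2)) + 1) = x u := by
    intro u hu hu'
    simp only [a]
    rw [if_neg (by omega), if_neg (by omega), if_neg (by omega), if_neg (by omega),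
      if_pos (by omega)]
    congr 1
    omega
  have hay : ∀ u, k + 2 ≤ u → u < 2 * k → a (2 * (u - (k + 2)) + 2) = y u := by
    intro u hu hu'
    simp only [a]
    rw [if_neg (by omega), if_neg (by omega), if_neg (by omega), if_neg (by omega),
      if_neg (by omega)]
    congr 1
    omega
  have hbx : ∀ u, 1 ≤ u → b (2 * u - 1) = x u := by
    intro u hu
    simp only [b]
    rw [if_pos (by omega)]
    congr 1
    omega
  have hby : ∀ u, b (2 * u) = y u := by
    intro u
    simp only [b]
    rw [if_neg (by omega)]
    congr 1
    omega
  have hxv : ∀ v : ZMod m, (Sum.inl v : ZMod m ⊕ ZMod m) = x v.val := fun v => by simp [x]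
  have hyv : ∀ v : ZMod m, (Sum.inr v : ZMod m ⊕ ZMod m) = y v.val := fun v => by simp [y]
  have hsurj : ∀ w, ∃ n < m, a n = w ∨ b n = w := by
    rintro (v | v)
    · have hv := ZMod.val_lt v
      rw [hxv]
      generalize v.val = v at hv
      rcases (by omega : v = 0 ∨ (1 ≤ v ∧ v ≤ k) ∨ v = k + 1 ∨ (k + 2 ≤ v ∧ v ≤ 2 * k)) with
        rfl | h | rfl | h
      · exact ⟨0, by omega, Or.inl ha0⟩
      · exact ⟨_, by omega, Or.inr (hbx v h.1)⟩
      · exact ⟨_, by omega, Or.inl ha1⟩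
      · exact ⟨_, by omega, Or.inl (hax v h.1 h.2)⟩
    · have hv := ZMod.val_lt v
      rw [hyv]
      generalize v.val = v at hv
      rcases (by omega : v ≤ k ∨ v = k + 1 ∨ (k + 2 ≤ v ∧ v < 2 * k) ∨ v = 2 * k) with
        h | rfl | h | rfl
      · exact ⟨_, by omega, Or.inr (hby v)⟩
      · exact ⟨_, by omega, Or.inl ha2⟩
      · exact ⟨_, by omega, Or.inl (hay v h.1 h.2)⟩
      · exact ⟨_, by omega, Or.inl ha3⟩
  obtain ⟨c, h1, h2, h3, h4⟩ := exists_pair_of_seq a b hsurj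
  have h2k : ((2 * k : ℕ) : ZMod m) = -1 := by
    rw [eq_neg_iff_add_eq_zero, ← Nat.cast_add_one, ← hm, ZMod.natCast_self]
  have hk1 : (k : ZMod m) + 1 = ((k + 1 : ℕ) : ZMod m) := by push_cast; rfl
  have hk2 : (k : ZMod m) + 2 = ((k + 2 : ℕ) : ZMod m) := by push_cast; rfl
  have hx0 : (Sum.inl 0 : ZMod m ⊕ ZMod m) = x 0 := by simp [x]
  have hy0 : (Sum.inr 0 : ZMod m ⊕ ZMod m) = y 0 := by simp [y]
  refine ⟨c, fun u hu hu' => ?_, fun u hu hu' => ?_, ?_, ?_, ?_, ?_⟩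
  · have hv := ZMod.val_lt u
    have hn0 : u.val ≠ 0 := fun h => hu ((ZMod.val_eq_zero u).1 h)
    have hn1 : u.val ≠ 2 * k := fun h => hu' (by rw [← ZMod.natCast_zmod_val u, h, h2k])
    rw [hxv, hyv]
    generalize u.val = v at hv hn0 hn1
    rcases (by omega : (1 ≤ v ∧ v ≤ k) ∨ v = k + 1 ∨ (k + 2 ≤ v ∧ v < 2 * k)) with h | rfl | h
    · rw [← hbx v h.1, ← hby v, h3 _ (by omega)]
      congr 1
      omega
    · rw [← ha1, ← ha2, h1 _ (by omega)]
      congr 1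
      omega
    · rw [← hax v h.1 h.2.le, ← hay v h.1 h.2, h1 _ (by omega)]
  · have hv := ZMod.val_lt u
    have hn0 : u.val ≠ k := fun h => hu (by rw [← ZMod.natCast_zmod_val u, h])
    have hn1 : u.val ≠ k + 1 := fun h => hu' (by rw [← ZMod.natCast_zmod_val u, h, hk1])
    have e : (Sum.inl (u + 1) : ZMod m ⊕ ZMod m) = x (u.val + 1) := by simp [x]
    rw [hyv, e]
    generalize u.val = v at hv hn0 hn1
    rcases (by omega : v < k ∨ (k + 2 ≤ v ∧ v < 2 * k) ∨ v = 2 * k) with h | h | rfl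
    · rw [← hby v, h3 _ (by omega), ← hbx (v + 1) (by omega)]
      congr 1
    · rw [← hay v h.1 h.2, h1 _ (by omega), ← hax (v + 1) (by omega) (by omega)]
      congr 1
      omega
    · have : x (2 * k + 1) = x 0 := by
        simp only [x]; rw [← hm, ZMod.natCast_self, Nat.cast_zero]
      rw [this, ← ha0, ← ha3, show 2 * k = m - 1 by omega]
      exact h2
  · have := hax (k + 2) le_rfl (by omega)
    rw [Nat.sub_self] at this
    rw [hx0, hk2, ← ha0, h1 _ (by omega)]
    exact this
  · rw [← h2k, hk1]
    change pairNext c (x (2 * k)) = x (k + 1)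
    rw [← hax (2 * k) (by omega) le_rfl, h1 _ (by omega), ← ha1]
    congr 1
    omega
  · rw [hk1, ← h2k]
    change pairNext c (y (k + 1)) = y (2 * k)
    rw [← ha2, h1 _ (by omega), ← ha3]
    congr 1
    omega
  · rw [hy0]
    change pairNext c (y k) = y 0
    rw [← hby k, ← hby 0, show 2 * k = m - 1 by omega]
    exact h4

/-- The spanning pair of cycles which uses two disjoint paths in the second summand. Each of them
is closed by a path with differences `q` in the first summand, of the length of the other path. -/
theorem exists_path_pair {m : ℕ} [NeZero m] {q : ZMod m} (hq : IsUnit q) (r : Fin 2 → ℕ)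
    (hr : r 0 + r 1 + 2 = m) (P : Fin 2 → ℕ → ZMod m)
    (hP : ∀ i, ∀ j ≤ r i, ∀ j' ≤ r i, P i j = P i j' → j = j')
    (hdisj : ∀ j ≤ r 0, ∀ j' ≤ r 1, P 0 j ≠ P 1 j') (a b a' b' : ZMod m)
    (hab : a + r 0 * q = b) (hba : b + q = a') (hab' : a' + r 1 * q = b') :
    ∃ c : Equiv.Perm (ZMod m ⊕ ZMod m),
      (∀ u : ZMod m, u ≠ b → u ≠ b' → pairNext c (Sum.inl u) = Sum.inl (u + q)) ∧
      (∀ i, ∀ j < r i, pairNext c (Sum.inr (P i j)) = Sum.inr (P i (j + 1))) ∧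
      pairNext c (Sum.inl b) = Sum.inr (P 1 0) ∧ pairNext c (Sum.inl b') = Sum.inr (P 0 0) ∧
      pairNext c (Sum.inr (P 1 (r 1))) = Sum.inl a ∧
      pairNext c (Sum.inr (P 0 (r 0))) = Sum.inl a' := by
  let f : ℕ → ZMod m ⊕ ZMod m := fun n =>
    if n ≤ r 0 then Sum.inl (a + n * q) else Sum.inr (P 1 (n - (r 0 + 1)))
  let g : ℕ → ZMod m ⊕ ZMod m := fun n =>
    if n ≤ r 1 then Sum.inl (a' + n * q) else Sum.inr (P 0 (n - (r 1 + 1)))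
  have hf0 : ∀ n ≤ r 0, f n = Sum.inl (a + n * q) := fun n hn => if_pos hn
  have hg0 : ∀ n ≤ r 1, g n = Sum.inl (a' + n * q) := fun n hn => if_pos hn
  have hf1 : ∀ n, f (n + (r 0 + 1)) = Sum.inr (P 1 n) := fun n => by
    simp only [f]; rw [if_neg (by omega), Nat.add_sub_cancel]
  have hg1 : ∀ n, g (n + (r 1 + 1)) = Sum.inr (P 0 n) := fun n => by
    simp only [g]; rw [if_neg (by omega), Nat.add_sub_cancel]
  have hx : ∀ u : ZMod m, (∃ n ≤ r 0, u = a + n * q) ∨ ∃ n ≤ r 1, u = a' + n * q := by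
    intro u
    obtain ⟨q, rfl⟩ := hq
    set w := (u - a) * (q⁻¹ : (ZMod m)ˣ) with hw
    have hu : u = a + w * q := by rw [hw, Units.inv_mul_cancel_right]; ring
    have hlt := ZMod.val_lt w
    by_cases h : w.val ≤ r 0
    · exact Or.inl ⟨w.val, h, by rw [ZMod.natCast_zmod_val, hu]⟩
    · refine Or.inr ⟨w.val - (r 0 + 1), by omega, ?_⟩
      rw [Nat.cast_sub (by omega), ZMod.natCast_zmod_val, hu, ← hba, ← hab]
      push_cast
      ring
  -- by counting, the two disjoint paths visit every vertex
  have hy : ∀ u : ZMod m, (∃ n ≤ r 1, P 1 n = u) ∨ ∃ n ≤ r 0, P 0 n = u := by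
    let F : Fin (r 1 + 1) ⊕ Fin (r 0 + 1) → ZMod m := Sum.elim (fun n => P 1 n) (fun n => P 0 n)
    have hF : Function.Injective F := by
      rintro (i | i) (j | j) h
      · exact congrArg Sum.inl (Fin.ext (hP 1 i (by omega) j (by omega) h))
      · exact absurd h.symm (hdisj j (by omega) i (by omega))
      · exact absurd h (hdisj i (by omega) j (by omega))
      · exact congrArg Sum.inr (Fin.ext (hP 0 i (by omega) j (by omega) h))
    have hb := (Fintype.bijective_iff_injective_and_card F).2 ⟨hF, by
      simp only [Fintype.card_sum, Fintype.card_fin, ZMod.card]; omega⟩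
    intro u
    obtain ⟨i | i, hi⟩ := hb.2 u
    · exact Or.inl ⟨i, by omega, hi⟩
    · exact Or.inr ⟨i, by omega, hi⟩
  have hsurj : ∀ w, ∃ n < m, f n = w ∨ g n = w := by
    rintro (u | u)
    · rcases hx u with ⟨n, hn, rfl⟩ | ⟨n, hn, rfl⟩
      · exact ⟨n, by omega, Or.inl (hf0 n hn)⟩
      · exact ⟨n, by omega, Or.inr (hg0 n hn)⟩
    · rcases hy u with ⟨n, hn, rfl⟩ | ⟨n, hn, rfl⟩
      · exact ⟨_, by omega, Or.inl (hf1 n)⟩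
      · exact ⟨_, by omega, Or.inr (hg1 n)⟩
  obtain ⟨c, h1, h2, h3, h4⟩ := exists_pair_of_seq f g hsurj
  refine ⟨c, fun u hu hu' => ?_, ?_, ?_, ?_, ?_, ?_⟩
  · rcases hx u with ⟨n, hn, rfl⟩ | ⟨n, hn, rfl⟩
    · have hn' : n ≠ r 0 := by rintro rfl; exact hu hab
      rw [← hf0 n hn, h1 n (by omega), hf0 (n + 1) (by omega)]
      push_cast
      congr 1
      ring
    · have hn' : n ≠ r 1 := by rintro rfl; exact hu' hab'
      rw [← hg0 n hn, h3 n (by omega), hg0 (n + 1) (by omega)]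
      push_cast
      congr 1
      ring
  · intro i j hj
    fin_cases i
    · change j < r 0 at hj
      change pairNext c (Sum.inr (P 0 j)) = Sum.inr (P 0 (j + 1))
      rw [← hg1, ← hg1, h3 _ (by omega)]
      congr 1
      omega
    · change j < r 1 at hj
      change pairNext c (Sum.inr (P 1 j)) = Sum.inr (P 1 (j + 1))
      rw [← hf1, ← hf1, h1 _ (by omega)]
      congr 1
      omega
  · rw [← hab, ← hf0 _ le_rfl, h1 _ (by omega), ← hf1 0]
    congr 1
    omega
  · rw [← hab', ← hg0 _ le_rfl, h3 _ (by omega), ← hg1 0]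
    congr 1
    omega
  · rw [← hf1, show r 1 + (r 0 + 1) = m - 1 by omega, h2, hf0 0 (by omega)]
    simp
  · rw [← hg1, show r 0 + (r 1 + 1) = m - 1 by omega, h4, hg0 0 (by omega)]
    simp

/-! ### The parameters in `ZMod m` -/

theorem pairNext_sumCongr_inl {m : ℕ} (c c' : Equiv.Perm (ZMod m)) (u : ZMod m) :
    pairNext (Equiv.sumCongr c c') (Sum.inl u) = Sum.inl (cycleNext c u) := by
  simp [pairNext, doubleShift, cycleNext]

theorem pairNext_sumCongr_inr {m : ℕ} (c c' : Equiv.Perm (ZMod m)) (u : ZMod m) :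
    pairNext (Equiv.sumCongr c c') (Sum.inr u) = Sum.inr (cycleNext c' u) := by
  simp [pairNext, doubleShift, cycleNext]

/-- The image of `exists_redirected_pair` under affine maps with the common slope `l`. -/
theorem exists_redirected_pair_affine {m k : ℕ} (hm : m = 2 * k + 1) (hk : 3 ≤ k) {l : ZMod m}
    (hl : IsUnit l) (b z : ZMod m) :
    ∃ c : Equiv.Perm (ZMod m ⊕ ZMod m),
      (∀ v : ZMod m, v ≠ b → v ≠ b - l → pairNext c (Sum.inl v) = Sum.inr (v - b + z)) ∧
      (∀ v : ZMod m, v ≠ z + l * k → v ≠ z + l * (k + 1) →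
        pairNext c (Sum.inr v) = Sum.inl (v - z + b + l)) ∧
      pairNext c (Sum.inl b) = Sum.inl (b + l * (k + 2)) ∧
      pairNext c (Sum.inl (b - l)) = Sum.inl (b + l * (k + 1)) ∧
      pairNext c (Sum.inr (z + l * (k + 1))) = Sum.inr (z - l) ∧
      pairNext c (Sum.inr (z + l * k)) = Sum.inr z := by
  obtain ⟨l, rfl⟩ := hl
  obtain ⟨c, h1, h2, h3, h4, h5, h6⟩ := exists_redirected_pair hm hk
  let e : Equiv.Perm (ZMod m ⊕ ZMod m) :=
    Equiv.sumCongr (l.mulLeft.trans (Equiv.addLeft b)) (l.mulLeft.trans (Equiv.addLeft z))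
  have hel : ∀ u : ZMod m, e (Sum.inl u) = Sum.inl (b + l * u) := fun u => rfl
  have her : ∀ u : ZMod m, e (Sum.inr u) = Sum.inr (z + l * u) := fun u => rfl
  have hsolve : ∀ y v : ZMod m, ∃ u : ZMod m, v = y + l * u := fun y v =>
    ⟨(l⁻¹ : (ZMod m)ˣ) * (v - y), by rw [Units.mul_inv_cancel_left]; ring⟩
  refine ⟨c.trans e, fun v hv hv' => ?_, fun v hv hv' => ?_, ?_, ?_, ?_, ?_⟩
  · obtain ⟨u, rfl⟩ := hsolve b v
    rw [← hel, pairNext_trans, h1 u ?_ ?_, her]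
    · congr 1; ring
    · rintro rfl; exact hv (by ring)
    · rintro rfl; exact hv' (by ring)
  · obtain ⟨u, rfl⟩ := hsolve z v
    rw [← her, pairNext_trans, h2 u ?_ ?_, hel]
    · congr 1; ring
    · rintro rfl; exact hv rfl
    · rintro rfl; exact hv' rfl
  · have : (Sum.inl b : ZMod m ⊕ ZMod m) = e (Sum.inl 0) := by rw [hel]; simp
    rw [this, pairNext_trans, h3, hel]
  · have : (Sum.inl (b - l) : ZMod m ⊕ ZMod m) = e (Sum.inl (-1)) := by
      rw [hel]; congr 1; ring
    rw [this, pairNext_trans, h4, hel]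
  · rw [← her, pairNext_trans, h5, her]
    congr 1; ring
  · rw [← her, pairNext_trans, h6, her]
    congr 1; ring

namespace CirculantParam

/-! In `ZMod m` with `m = 2 * k + 1` one has `k = -1 / 2`, and the parameters have the values
`d = 9 / 8`, `s₁' = -1 / 8`, `s₂' = 5 / 8`, `t₁ = 1 / 4`, `t₂ = -5 / 4`, irrespective of `k` modulo
`4`. -/

theorem eight_mul_d (k : ℕ) : (8 : ZMod (2 * k + 1)) * d k = 9 := by
  have h : ∃ e, 8 * d k = 9 + e * (2 * k + 1) := by
    unfold d
    split_ifs
    exacts [⟨7, by omega⟩, ⟨5, by omega⟩, ⟨3, by omega⟩, ⟨1, by omega⟩]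
  obtain ⟨e, he⟩ := h
  have h1 := congrArg (Nat.cast : ℕ → ZMod (2 * k + 1)) he
  rw [Nat.cast_add, Nat.cast_mul e, ZMod.natCast_self] at h1
  push_cast at h1
  linear_combination h1

theorem eight_mul_s'_zero (k : ℕ) : (8 : ZMod (2 * k + 1)) * s' k 0 = -1 := by
  have h : ∃ e, 8 * s' k 0 + 1 = e * (2 * k + 1) := by
    unfold s'
    split_ifs <;> simp only [Matrix.cons_val_zero]
    exacts [⟨1, by omega⟩, ⟨3, by omega⟩, ⟨5, by omega⟩, ⟨7, by omega⟩]
  obtain ⟨e, he⟩ := h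
  have h1 := congrArg (Nat.cast : ℕ → ZMod (2 * k + 1)) he
  rw [Nat.cast_mul e, ZMod.natCast_self] at h1
  push_cast at h1
  linear_combination h1

theorem eight_mul_s'_one (k : ℕ) : (8 : ZMod (2 * k + 1)) * s' k 1 = 5 := by
  have h : ∃ e, 8 * s' k 1 = 5 + e * (2 * k + 1) := by
    unfold s'
    split_ifs <;> simp only [Matrix.cons_val_one, Matrix.cons_val_fin_one]
    exacts [⟨3, by omega⟩, ⟨1, by omega⟩, ⟨7, by omega⟩, ⟨5, by omega⟩]
  obtain ⟨e, he⟩ := h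
  have h1 := congrArg (Nat.cast : ℕ → ZMod (2 * k + 1)) he
  rw [Nat.cast_add, Nat.cast_mul e, ZMod.natCast_self] at h1
  push_cast at h1
  linear_combination h1

theorem four_mul_t'_one {k : ℕ} (hk : 2 ≤ k) : (4 : ZMod (2 * k + 1)) * t' k 1 = -5 := by
  have h : ∃ e, 4 * t' k 1 + 5 = e * (2 * k + 1) := by
    simp only [t', Matrix.cons_val_one, Matrix.cons_val_fin_one]
    split_ifs
    exacts [⟨1, by omega⟩, ⟨3, by omega⟩]
  obtain ⟨e, he⟩ := h
  have h1 := congrArg (Nat.cast : ℕ → ZMod (2 * k + 1)) he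
  rw [Nat.cast_mul e, ZMod.natCast_self] at h1
  push_cast at h1
  linear_combination h1

theorem four_mul_t_zero (k : ℕ) : (4 : ZMod (2 * k + 1)) * t k 0 = 1 := by
  have h : ∃ e, 4 * t k 0 = 1 + e * (2 * k + 1) := by
    simp only [t, Matrix.cons_val_zero]
    split_ifs
    exacts [⟨3, by omega⟩, ⟨1, by omega⟩]
  obtain ⟨e, he⟩ := h
  have h1 := congrArg (Nat.cast : ℕ → ZMod (2 * k + 1)) he
  rw [Nat.cast_add, Nat.cast_mul e, ZMod.natCast_self] at h1
  push_cast at h1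
  linear_combination h1

theorem two_mul_cast (k : ℕ) : (2 : ZMod (2 * k + 1)) * k = -1 := by
  have h : ((2 * k + 1 : ℕ) : ZMod (2 * k + 1)) = 0 := ZMod.natCast_self _
  push_cast at h
  linear_combination h

theorem s_zero {k : ℕ} (hk : 1 ≤ k) : (s k 0 : ZMod (2 * k + 1)) = -2 := by
  have h : s k 0 + 1 = 2 * k := by simp only [s, Matrix.cons_val_zero]; omega
  have h1 := congrArg (Nat.cast : ℕ → ZMod (2 * k + 1)) h
  push_cast at h1
  linear_combination h1 + two_mul_cast k

theorem isUnit_two (k : ℕ) : IsUnit (2 : ZMod (2 * k + 1)) :=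
  IsUnit.of_mul_eq_one (-k) (by linear_combination -two_mul_cast k)

theorem isUnit_eight (k : ℕ) : IsUnit (8 : ZMod (2 * k + 1)) := by
  have := (isUnit_two k).pow 3
  rwa [show (2 : ZMod (2 * k + 1)) ^ 3 = 8 by norm_num] at this

theorem isUnit_three {k : ℕ} (h3 : ¬ 3 ∣ 2 * k + 1) : IsUnit (3 : ZMod (2 * k + 1)) :=
  (ZMod.isUnit_iff_coprime 3 _).2 ((Nat.Prime.coprime_iff_not_dvd Nat.prime_three).2 h3)

theorem isUnit_d {k : ℕ} (h3 : ¬ 3 ∣ 2 * k + 1) : IsUnit (d k : ZMod (2 * k + 1)) := by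
  have h9 : IsUnit (9 : ZMod (2 * k + 1)) := by
    have := (isUnit_three h3).pow 2
    rwa [show (3 : ZMod (2 * k + 1)) ^ 2 = 9 by norm_num] at this
  rw [← eight_mul_d k] at h9
  exact isUnit_of_mul_isUnit_right h9

/-- The path lengths are `r₁ = -1 / 3` and `r₂ = -5 / 3` in `ZMod m`, and so the two paths visit
`m` vertices. -/
theorem val_add_val {k : ℕ} (hk : 3 ≤ k) (h3 : ¬ 3 ∣ 2 * k + 1) (r : Fin 2 → ZMod (2 * k + 1))
    (hr : ∀ i, (s' k i : ZMod (2 * k + 1)) + r i * d k = t' k i) :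
    (r 0).val + (r 1).val + 2 = 2 * k + 1 := by
  have h0 : 3 * r 0 = -1 := by
    apply (isUnit_three h3).mul_left_cancel
    have ht : (t' k 0 : ZMod (2 * k + 1)) = k := by simp [t']
    linear_combination 8 * hr 0 - eight_mul_s'_zero k - r 0 * eight_mul_d k + 8 * ht
      + 4 * two_mul_cast k
  have h1 : 3 * r 1 = -5 := by
    apply (isUnit_three h3).mul_left_cancel
    linear_combination 8 * hr 1 - eight_mul_s'_one k - r 1 * eight_mul_d k
      + 2 * four_mul_t'_one (by omega : 2 ≤ k)
  have hsum : r 0 + r 1 + 2 = 0 := by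
    apply (isUnit_three h3).mul_left_cancel
    linear_combination h0 + h1
  have hcast : (((r 0).val + (r 1).val + 2 : ℕ) : ZMod (2 * k + 1)) = 0 := by
    push_cast
    rw [ZMod.natCast_zmod_val, ZMod.natCast_zmod_val, hsum]
  rw [ZMod.natCast_eq_zero_iff] at hcast
  obtain ⟨n, hn⟩ := hcast
  have hlt0 := ZMod.val_lt (r 0)
  have hlt1 := ZMod.val_lt (r 1)
  have hne : (r 0).val ≠ 2 * k := by
    intro h
    have h4 : r 0 = -1 := by
      rw [← ZMod.natCast_zmod_val (r 0), h]
      push_cast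
      exact two_mul_cast k
    rw [h4] at h0
    have h5 : ((2 : ℕ) : ZMod (2 * k + 1)) = (0 : ℕ) := by push_cast; linear_combination -h0
    have := ZMod.eq_of_natCast_eq (by omega) (by omega) h5
    omega
  have hn2 : n < 2 := by
    by_contra hge
    have : (2 * k + 1) * 2 ≤ (2 * k + 1) * n := Nat.mul_le_mul_left _ (by omega)
    omega
  have hn0 : n ≠ 0 := by rintro rfl; omega
  obtain rfl : n = 1 := by omega
  omega

end CirculantParam

/-! ### The resolution classes -/

theorem ncard_compl_of_ncard_eq_three {m : ℕ} [NeZero m] {A : Set (ZMod m)} (h : A.ncard = 3) :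
    Nat.card ↥(Aᶜ) = m - 3 := by
  have := Set.ncard_add_ncard_compl A
  rw [Nat.card_zmod, h] at this
  rw [Nat.card_coe_set_eq]
  omega

/-- The resolution classes are indexed by the elements of `ZMod m` other than `0`, `1`, `q` (a
Hamiltonian cycle in each summand), the elements of `ZMod m` (the translates of the starter) and a
Boolean (the two special classes); `Sum.inl` are the vertices `x_i` and `Sum.inr` the vertices
`y_i`. -/
theorem resolvable_of_decompositions {m k : ℕ} (hm : m = 2 * k + 1) (hk : 3 ≤ k) (h3 : ¬ 3 ∣ m)
    (s t r : Fin 2 → ZMod m)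
    (hs : ∀ i, s i = (CirculantParam.s k i : ZMod m))
    (ht : ∀ i, t i = (CirculantParam.t k i : ZMod m))
    (hr : ∀ i, (CirculantParam.s' k i : ZMod m) + r i * CirculantParam.d k =
      CirculantParam.t' k i) (S : Set (ZMod m)) (hS : S ⊆ {x | x ≠ 0})
    (hkS : (k : ZMod m) + 1 ∉ S) (hst : ∀ i, s i - t i ∈ S)
    (h1 : (Digraph.directedCirculant m
      ({x | x ≠ 0} \ (S ∪ {(k : ZMod m) + 1}))).AdmitsDirectedCycleDecomposition m)
    (h2 : ((Digraph.directedCirculant m S).deleteArcs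
      {(t 0, s 0), (t 1, s 1)}).AdmitsDirectedCyclesTwoPathsDecomposition m s t
        (fun i => (r i).val)) :
    (Digraph.completeSymmetric (Fin (2 * m))).AdmitsResolvableDirectedCycleDecomposition m := by
  have hr2 : (r 0).val + (r 1).val + 2 = m := by
    subst hm; exact CirculantParam.val_add_val hk h3 r hr
  have h2k : (2 : ZMod m) * k = -1 := by subst hm; exact CirculantParam.two_mul_cast k
  have h8d : (8 : ZMod m) * CirculantParam.d k = 9 := by
    subst hm; exact CirculantParam.eight_mul_d k
  have hs0' : (8 : ZMod m) * CirculantParam.s' k 0 = -1 := by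
    subst hm; exact CirculantParam.eight_mul_s'_zero k
  have hs1' : (8 : ZMod m) * CirculantParam.s' k 1 = 5 := by
    subst hm; exact CirculantParam.eight_mul_s'_one k
  have htk : (CirculantParam.t' k 0 : ZMod m) = k := by simp [CirculantParam.t']
  have htk1 : (4 : ZMod m) * CirculantParam.t' k 1 = -5 := by
    subst hm; exact CirculantParam.four_mul_t'_one (by omega)
  have hs0 : s 0 = -2 := by rw [hs]; subst hm; exact CirculantParam.s_zero (by omega)
  have hs1 : s 1 = k := by rw [hs]; simp [CirculantParam.s]
  have ht0 : 4 * t 0 = 1 := by rw [ht]; subst hm; exact CirculantParam.four_mul_t_zero k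
  have ht1 : 4 * t 1 = -5 := by rw [ht]; exact htk1
  have hu8 : IsUnit (8 : ZMod m) := by subst hm; exact CirculantParam.isUnit_eight k
  have hu2 : IsUnit (2 : ZMod m) := by subst hm; exact CirculantParam.isUnit_two k
  have hu3 : IsUnit (3 : ZMod m) := by subst hm; exact CirculantParam.isUnit_three h3
  have hud : IsUnit (CirculantParam.d k : ZMod m) := by
    subst hm; exact CirculantParam.isUnit_d h3
  have : NeZero m := ⟨by omega⟩
  have : Fact (1 < m) := ⟨by omega⟩
  have hne : ∀ n : ℕ, 0 < n → n < m → (n : ZMod m) ≠ 0 := by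
    intro n hn hn' h
    have := ZMod.eq_of_natCast_eq (n := m) (i := n) (j := 0) hn' (by omega) (by simpa using h)
    omega
  obtain ⟨q, hq⟩ : ∃ q : ZMod m, q = 2 * CirculantParam.d k := ⟨_, rfl⟩
  have h4q : 4 * q = 9 := by rw [hq]; linear_combination h8d
  have huq : IsUnit q := hq ▸ hu2.mul hud
  have hq1 : q ≠ 1 := by
    intro h
    rw [h] at h4q
    exact hne 5 (by omega) (by omega) (by push_cast; linear_combination -h4q)
  have hul : IsUnit ((k : ZMod m) + 2) := by
    refine isUnit_of_mul_isUnit_right (x := 2) ?_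
    rwa [show (2 : ZMod m) * (k + 2) = 3 by linear_combination h2k]
  have he0 : (k : ZMod m) + 1 ≠ 0 := by
    intro h
    exact hne (k + 1) (by omega) (by omega) (by push_cast; exact h)
  obtain ⟨T, cY, P, hT, hcard, hPend, hPinj, hPdisj, hcovY⟩ :=
    exists_cycles_of_decompositions ((k : ZMod m) + 1) he0 s t (fun i => (r i).val) S hS hkS hst
      h1 h2
  obtain ⟨cX, hcovX⟩ := hamiltonCovered_compl ⟨k, hm⟩ (by omega) huq hq1
  obtain ⟨cF, hFxx, hFyy, hFxy, hFyx⟩ := Starter.exists_starter hm hk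
  -- the last vertices of the two paths in the first summand: the arcs of type `xy` leaving them
  -- have difference `k + 3` and lead to the first vertices of the two given paths
  obtain ⟨b, hb⟩ : ∃ b, b = s 1 - (k + 3) := ⟨_, rfl⟩
  obtain ⟨b', hb'⟩ : ∃ b', b' = s 0 - (k + 3) := ⟨_, rfl⟩
  obtain ⟨c0, h0x, h0y, h0b, h0b', h0t1, h0t0⟩ := exists_path_pair huq (fun i => (r i).val) hr2 P
    hPinj hPdisj (t 1 - 1) b (t 0 - 1) b'
    (by
      rw [ZMod.natCast_zmod_val]
      apply hu8.mul_left_cancel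
      rw [hb, hs1, hq]
      linear_combination 2 * ht1 + 16 * hr 0 - 2 * hs0' + 16 * htk + 8 * h2k)
    (by
      apply hu8.mul_left_cancel
      rw [hb, hs1]
      linear_combination 2 * h4q - 2 * ht0)
    (by
      rw [ZMod.natCast_zmod_val]
      apply hu8.mul_left_cancel
      rw [hb', hs0, hq]
      linear_combination 2 * ht0 + 16 * hr 1 - 2 * hs1' + 4 * htk1 + 4 * h2k)
  obtain ⟨c1, h1x, h1y, h1b, h1b', h1t0, h1t1⟩ := exists_redirected_pair_affine hm hk hul b (s 1)
  -- the redirected arcs are the deleted arcs and the two missing arcs with difference `q`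
  have hbl : b - (k + 2) = b' := by
    rw [hb, hb', hs1, hs0]; ring
  have ht0' : s 1 + (k + 2) * (k + 1) = t 0 := by
    apply hu8.mul_left_cancel
    rw [hs1]
    linear_combination (4 * (k : ZMod m) + 14) * h2k - 2 * ht0
  have ht1' : s 1 + (k + 2) * k = t 1 := by
    apply hu8.mul_left_cancel
    rw [hs1]
    linear_combination (4 * (k : ZMod m) + 10) * h2k - 2 * ht1
  have hbq : b + (k + 2) * (k + 2) = b + q := by
    apply hu8.mul_left_cancel
    linear_combination (4 * (k : ZMod m) + 14) * h2k - 2 * h4q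
  have hbq' : b + (k + 2) * (k + 1) = b' + q := by
    apply hu8.mul_left_cancel
    rw [← hbl]
    linear_combination (4 * (k : ZMod m) + 14) * h2k - 2 * h4q
  rw [hbl] at h1x h1b'
  rw [ht0'] at h1y h1t0
  rw [ht1'] at h1y h1t1
  rw [hbq] at h1b
  rw [hbq'] at h1b'
  have hsl : s 1 - (k + 2) = s 0 := by rw [hs1, hs0]; ring
  rw [hsl] at h1t0
  -- there are as many Hamiltonian cycles in the first summand as indices left in the second one
  have hD3 : ({0, 1, q} : Set (ZMod m)).ncard = 3 := by
    rw [Set.ncard_eq_three]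
    exact ⟨_, _, _, zero_ne_one, huq.ne_zero.symm, hq1.symm, rfl⟩
  have hDeq : {x : ZMod m | x ≠ 0 ∧ x ≠ 1 ∧ x ≠ q} = ({0, 1, q} : Set (ZMod m))ᶜ := by
    ext x; simp
  rw [hDeq] at hcovX
  have : Nonempty (↥(({0, 1, q} : Set (ZMod m))ᶜ) ≃
      ↥(({t 0, t 0 + (k + 1), s 0} : Set (ZMod m))ᶜ)) := by
    rw [← Finite.card_eq, ncard_compl_of_ncard_eq_three hD3, ncard_compl_of_ncard_eq_three hcard]
  obtain ⟨ψ⟩ := this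
  classical
  let τ : ZMod m → Equiv.Perm (ZMod m ⊕ ZMod m) := fun j =>
    Equiv.sumCongr (Equiv.addRight j) (Equiv.addRight j)
  let cls : (↥(({0, 1, q} : Set (ZMod m))ᶜ) ⊕ (ZMod m ⊕ Bool)) → Equiv.Perm (ZMod m ⊕ ZMod m) :=
    Sum.elim (fun x => Equiv.sumCongr (cX x) (cY (ψ x)))
      (Sum.elim (fun j => cF.trans (τ j)) fun i => if i then c0 else c1)
  have hrot : ∀ j u, pairNext (cls (Sum.inr (Sum.inl j))) (τ j u) = τ j (pairNext cF u) :=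
    fun j u => pairNext_trans cF (τ j) u
  have hτl : ∀ j u : ZMod m, τ j (Sum.inl u) = Sum.inl (u + j) := fun j u => rfl
  have hτr : ∀ j u : ZMod m, τ j (Sum.inr u) = Sum.inr (u + j) := fun j u => rfl
  refine Digraph.admitsResolvable_of_covering (m := m) (by omega) ?_ cls ?_
  · have h5 := ncard_compl_of_ncard_eq_three hD3
    rw [Nat.card_eq_fintype_card] at h5
    rw [Fintype.card_sum, Fintype.card_sum, ZMod.card, Fintype.card_bool, h5]
    omega
  rintro (i | i) (j | j) hij
  -- type `xx`: difference `1` in the starter, difference `q` in the special classes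
  · by_cases hj1 : j = i + 1
    · obtain ⟨a, ha⟩ := hFxx
      refine ⟨Sum.inr (Sum.inl (i - a)), ?_⟩
      have := hrot (i - a) (Sum.inl a)
      rw [ha, hτl, hτl, add_sub_cancel] at this
      rw [this, hj1]
      congr 1; ring
    · by_cases hjq : j = i + q
      · subst hjq
        by_cases hib : i = b
        · subst hib
          exact ⟨Sum.inr (Sum.inr false), h1b⟩
        · by_cases hib' : i = b'
          · subst hib'
            exact ⟨Sum.inr (Sum.inr false), h1b'⟩
          · exact ⟨Sum.inr (Sum.inr true), h0x i hib hib'⟩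
      · obtain ⟨x, hx, hxj⟩ := hcovX (j - i) (by
          rintro (h | h | h)
          · exact hij (by rw [sub_eq_zero.1 h])
          · exact hj1 (by linear_combination h)
          · rw [Set.mem_singleton_iff] at h
            exact hjq (by linear_combination h)) i
        refine ⟨Sum.inl ⟨x, hx⟩, ?_⟩
        change pairNext (Equiv.sumCongr (cX x) _) _ = _
        rw [pairNext_sumCongr_inl, hxj, add_sub_cancel]
  -- type `xy`: difference `k + 3` in the special classes, all others in the starter
  · by_cases hδ : j - i = k + 3
    · obtain rfl : j = i + (k + 3) := by linear_combination hδ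
      by_cases hib : i = b
      · subst hib
        refine ⟨Sum.inr (Sum.inr true), ?_⟩
        change pairNext c0 _ = _
        rw [h0b, (hPend 1).1, hb, sub_add_cancel]
      · by_cases hib' : i = b'
        · subst hib'
          refine ⟨Sum.inr (Sum.inr true), ?_⟩
          change pairNext c0 _ = _
          rw [h0b', (hPend 0).1, hb', sub_add_cancel]
        · refine ⟨Sum.inr (Sum.inr false), (h1x i hib hib').trans ?_⟩
          rw [hb]
          congr 1; ring
    · obtain ⟨a, ha⟩ := hFxy _ hδ
      refine ⟨Sum.inr (Sum.inl (i - a)), ?_⟩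
      have := hrot (i - a) (Sum.inl a)
      rw [ha, hτl, hτr, add_sub_cancel] at this
      rw [this]
      congr 1; ring
  -- type `yx`: difference `-1` in the special classes, all others in the starter
  · by_cases hδ : j - i = -1
    · obtain rfl : j = i - 1 := by linear_combination hδ
      by_cases hi0 : i = t 0
      · subst hi0
        refine ⟨Sum.inr (Sum.inr true), ?_⟩
        rw [(hPend 0).2] at h0t0
        exact h0t0
      · by_cases hi1 : i = t 1
        · subst hi1
          refine ⟨Sum.inr (Sum.inr true), ?_⟩
          rw [(hPend 1).2] at h0t1
          exact h0t1
        · refine ⟨Sum.inr (Sum.inr false), (h1y i hi1 hi0).trans ?_⟩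
          rw [hb]
          congr 1; ring
    · obtain ⟨a, ha⟩ := hFyx _ hδ
      refine ⟨Sum.inr (Sum.inl (i - a)), ?_⟩
      have := hrot (i - a) (Sum.inr a)
      rw [ha, hτr, hτl, add_sub_cancel] at this
      rw [this]
      congr 1; ring
  -- type `yy`: difference `k + 1` in the starter, all others in the given decompositions
  · by_cases hδ : j - i = k + 1
    · obtain ⟨a, ha⟩ := hFyy
      refine ⟨Sum.inr (Sum.inl (i - a)), ?_⟩
      have := hrot (i - a) (Sum.inr a)
      rw [ha, hτr, hτr, add_sub_cancel] at this
      rw [this]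
      congr 1; linear_combination -hδ
    · rcases hcovY i j (fun h => hij (by rw [h])) hδ with ⟨n, rfl, rfl⟩ | ⟨n, l, hl, rfl, rfl⟩ |
        ⟨w, hw, hwj⟩
      · refine ⟨Sum.inr (Sum.inr false), ?_⟩
        fin_cases n
        · exact h1t0
        · exact h1t1
      · exact ⟨Sum.inr (Sum.inr true), h0y n l hl⟩
      · refine ⟨Sum.inl (ψ.symm ⟨w, hT hw⟩), ?_⟩
        change pairNext (Equiv.sumCongr _ (cY (ψ (ψ.symm ⟨w, hT hw⟩)))) _ = _
        rw [pairNext_sumCongr_inr, Equiv.apply_symm_apply, hwj]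

theorem mainTheorem3 (m k : ℕ) (hodd : Odd m) (h3 : ¬ 3 ∣ m) (h7 : 7 ≤ m) (h11 : m ≠ 11)
    (hk : k = (m - 1) / 2) :
    Nat.gcd (CirculantParam.d k) m = 1 ∧
    (∀ i : Fin 2, ∃! r : ZMod m,
      (CirculantParam.s' k i : ZMod m) + r * (CirculantParam.d k : ZMod m) =
        (CirculantParam.t' k i : ZMod m)) ∧
    ∀ (s t r : Fin 2 → ZMod m),
      (∀ i, s i = (CirculantParam.s k i : ZMod m)) →
      (∀ i, t i = (CirculantParam.t k i : ZMod m)) →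
      (∀ i, (CirculantParam.s' k i : ZMod m) + r i * (CirculantParam.d k : ZMod m) =
        (CirculantParam.t' k i : ZMod m)) →
      (∃ S : Set (ZMod m), S ⊆ {x | x ≠ 0} ∧
        (k : ZMod m) + 1 ∉ S ∧
        (∀ i, s i - t i ∈ S) ∧
        (Digraph.directedCirculant m
          ({x | x ≠ 0} \ (S ∪ {(k : ZMod m) + 1}))).AdmitsDirectedCycleDecomposition m ∧
        ((Digraph.directedCirculant m S).deleteArcs
          {(t 0, s 0), (t 1, s 1)}).AdmitsDirectedCyclesTwoPathsDecomposition m s t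
            (fun i => (r i).val)) →
      (Digraph.completeSymmetric
        (Fin (2 * m))).AdmitsResolvableDirectedCycleDecomposition m := by
  obtain ⟨l, rfl⟩ := hodd
  obtain rfl : k = l := by omega
  have hd := CirculantParam.isUnit_d h3
  refine ⟨(ZMod.isUnit_iff_coprime _ _).1 hd, fun i => ?_, ?_⟩
  · obtain ⟨d, hd⟩ := hd
    rw [← hd]
    refine ⟨(CirculantParam.t' k i - CirculantParam.s' k i) * (d⁻¹ : (ZMod (2 * k + 1))ˣ), ?_, ?_⟩
    · dsimp only
      rw [Units.inv_mul_cancel_right]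
      ring
    · intro r hr
      rw [Units.eq_mul_inv_iff_mul_eq]
      linear_combination hr
  · rintro s t r hs ht hr ⟨S, hS, hkS, hst, h1, h2⟩
    exact resolvable_of_decompositions rfl (by omega) h3 s t r hs ht hr S hS hkS hst h1 h2
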